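/- Let $d\in\{2,3\}$, $k\ge 1$, $n\in\mathbb N$. Let $T\subset\mathbb R^d$ be a (bounded, nondegenerate) convex polygon ($d=2$) or convex polyhedron ($d=3$) with diameter $h_T$ and with exactly $n$ edges/faces $e_1,\dots,e_n$ (lying in pairwise distinct lines/planes). Write $h_{e_i}$ for the diameter of $e_i$, $m_1$ for the barycenter of $e_1$, and $\mathbf n$ for the outward unit normal of $T$ on $e_1$. For $m\ge 0$ let $P_m(K)$ be the space of (restrictions to $K$ of) polynomials of total degree at most $m$ in $d$ variables, and let $(\cdot,\cdot)_T$, $\|\cdot\|_T$ and $\langle\cdot,\cdot\rangle_{e_1}$, $\|\cdot\|_{e_1}$ be the inner products and norms of $L^2(T)$ and of $L^2(e_1)$ (with respect to length/area). For $i=2,\dots,n$ let $\lambda_i\in P_1(T)$ be the polynomial with $\lambda_i|_{e_i}=0$ and $\lambda_i(m_1)=1$. (i) For every $g\in P_{k-1}(e_1)$ there is a unique polynomial $q$ of the form $q=\lambda_2^2\cdots\lambda_n^2\,q_{k+1}$ with $q_{k+1}\in P_{k+1}(T)$ such that $$(q,p)_T=0\quad\forall p\in P_{k-1}(T),$$ $$\langle\nabla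 q\cdot\mathbf n,p\rangle_{e_1}=0\quad\forall p\in P_k(e_1),$$ $$\langle q-g,p\rangle_{e_1}=0\quad\forall p\in P_{k+1}(e_1).$$ (ii) For all $\alpha_0,\rho,\kappa>0$ there is a constant $C>0$, depending only on $d,n,k,\alpha_0,\rho,\kappa$, such that $$\|q\|_T\le C\,h_T^{1/2}\,\|g\|_{e_1}$$ for all $T$, $e_1$, $g$ and $q$ as in (i), provided that: the interior angle of $T$ between $e_1$ and each neighboring edge/face $e_i$ (one that meets $e_1$ in a vertex if $d=2$, in an edge if $d=3$) lies in $[\alpha_0,\pi-\alpha_0]$; $h_{e_i}\ge\rho\,h_T$ for all $i$; and $\operatorname{dist}(m_1,e_1\cap e_i)\ge\kappa\,h_{e_1}$ for each neighboring edge/face $e_i$ (for $d=2$ this always holds with $\kappa=1/2$). -/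

import Mathlib

open MeasureTheory

noncomputable section

/-- A bounded convex polytope in `ℝ^d` (a convex polygon for `d = 2`, a convex polyhedron for
`d = 3`) with exactly `n` facets (edges, flat faces), given by the outward unit normals and the
offsets of the hyperplanes that carry the facets. -/
structure ConvexPolytope (d n : ℕ) where
  /-- outward unit normal of the `i`-th facet -/
  normal : Fin n → EuclideanSpace ℝ (Fin d)
  norm_normal : ∀ i, ‖normal i‖ = 1
  /-- the `i`-th facet lies in the hyperplane `⟪normal i, x⟫ = offset i` -/
  offset : Fin n → ℝ
  bounded : Bornology.IsBounded {x | ∀ i, inner ℝ (normal i) x ≤ offset i}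
  interior_nonempty : ∃ x, ∀ i, inner ℝ (normal i) x < offset i
  /-- Every hyperplane carries a facet of its own: the `i`-th face has a point that lies
  strictly inside all other half-spaces. Hence each face has dimension `d - 1`, and the
  hyperplanes are pairwise distinct. -/
  irredundant : ∀ i, ∃ x, inner ℝ (normal i) x = offset i ∧
    ∀ j, j ≠ i → inner ℝ (normal j) x < offset j

namespace ConvexPolytope

variable {d n : ℕ}

/-- The polytope `T` as a set. -/
def carrier (T : ConvexPolytope d n) : Set (EuclideanSpace ℝ (Fin d)) :=
  {x | ∀ i, inner ℝ (T.normal i) x ≤ T.offset i}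

/-- The facet (edge or flat face) `e_i` of `T`. -/
def face (T : ConvexPolytope d n) (i : Fin n) : Set (EuclideanSpace ℝ (Fin d)) :=
  {x | x ∈ T.carrier ∧ inner ℝ (T.normal i) x = T.offset i}

/-- The surface measure on the facet `e_i`: the `(d-1)`-dimensional Hausdorff measure, normalized
so that it is length for `d = 2` and area for `d = 3`. -/
def surfaceMeasure (T : ConvexPolytope d n) (i : Fin n) :
    Measure (EuclideanSpace ℝ (Fin d)) :=
  (μHE[d - 1] : Measure (EuclideanSpace ℝ (Fin d))).restrict (T.face i)

/-- The barycenter of the facet `e_i`. -/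
def faceBarycenter (T : ConvexPolytope d n) (i : Fin n) : EuclideanSpace ℝ (Fin d) :=
  ⨍ x, x ∂(T.surfaceMeasure i)

/-- The facets `e_i` and `e_j` are neighbors: they are different and meet in a vertex if `d = 2`,
in an edge if `d = 3`, that is, in a nonempty set of dimension `d - 2`. -/
def Adjacent (T : ConvexPolytope d n) (i j : Fin n) : Prop :=
  i ≠ j ∧ (T.face i ∩ T.face j).Nonempty ∧
    Module.finrank ℝ (vectorSpan ℝ (T.face i ∩ T.face j)) = d - 2

/-- Shape regularity of `T` relative to its facet `e_i`, with parameters `α₀` (angles), `ρ`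
(smallest ratio of facet size to element size) and `κ` (position of the barycenter of `e_i`).
The interior angle between two neighboring facets is `π` minus the angle between their outward
normals. For `d = 2` the last condition always holds with `κ = 1/2`. -/
structure IsRegularAt (T : ConvexPolytope d n) (i : Fin n) (α₀ ρ κ : ℝ) : Prop where
  angle_ge : ∀ j, T.Adjacent i j →
    α₀ ≤ InnerProductGeometry.angle (T.normal i) (T.normal j)
  angle_le : ∀ j, T.Adjacent i j →
    InnerProductGeometry.angle (T.normal i) (T.normal j) ≤ Real.pi - α₀
  ratio : ∀ j, ρ * Metric.diam T.carrier ≤ Metric.diam (T.face j)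
  barycenter : ∀ j, T.Adjacent i j →
    κ * Metric.diam (T.face i) ≤ Metric.infDist (T.faceBarycenter i) (T.face i ∩ T.face j)

end ConvexPolytope

/-- The value of the polynomial `p` at a point of `ℝ^d`. -/
def polyVal {d : ℕ} (p : MvPolynomial (Fin d) ℝ) (x : EuclideanSpace ℝ (Fin d)) : ℝ :=
  MvPolynomial.eval (fun j => x j) p

/-- The directional derivative `∇p · v` of the polynomial `p` at a point of `ℝ^d`. -/
def polyDirDeriv {d : ℕ} (p : MvPolynomial (Fin d) ℝ) (v x : EuclideanSpace ℝ (Fin d)) : ℝ :=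
  ∑ j, polyVal (MvPolynomial.pderiv j p) x * v j

/-- Polynomials of total degree at most `m` in `d` variables. The elements of `P_m(T)` and
`P_m(e)` are the restrictions of these polynomials to `T` and to `e`. -/
abbrev PolyDeg (d m : ℕ) : Submodule ℝ (MvPolynomial (Fin d) ℝ) :=
  MvPolynomial.restrictTotalDegree (Fin d) ℝ m

namespace ConvexPolytope

variable {d n : ℕ}

/-- The norm of `p` in `L²(T)`. -/
def normL2 (T : ConvexPolytope d n) (p : MvPolynomial (Fin d) ℝ) : ℝ :=
  Real.sqrt (∫ x in T.carrier, polyVal p x ^ 2)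

/-- The norm of `p` in `L²(e_i)`. -/
def faceNormL2 (T : ConvexPolytope d n) (i : Fin n) (p : MvPolynomial (Fin d) ℝ) : ℝ :=
  Real.sqrt (∫ x, polyVal p x ^ 2 ∂(T.surfaceMeasure i))

/-- `lam j`, for `j ≠ i`, is the polynomial of degree at most one that vanishes on the facet `e_j`
and equals one at the barycenter of the facet `e_i`. -/
def IsWeightFamily (T : ConvexPolytope d n) (i : Fin n)
    (lam : Fin n → MvPolynomial (Fin d) ℝ) : Prop :=
  ∀ j, j ≠ i → lam j ∈ PolyDeg d 1 ∧ (∀ x ∈ T.face j, polyVal (lam j) x = 0) ∧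
    polyVal (lam j) (T.faceBarycenter i) = 1

/-- `q` is the product of all `lam j ^ 2`, `j ≠ i`, and of a polynomial of degree at most `k + 1`;
`q` is orthogonal to `P_{k-1}(T)`; `∇q · n` is orthogonal to `P_k(e_i)` on `e_i`, and `q - g` is
orthogonal to `P_{k+1}(e_i)` on `e_i`. -/
structure IsBubbleExtension (T : ConvexPolytope d n) (i : Fin n)
    (lam : Fin n → MvPolynomial (Fin d) ℝ) (k : ℕ) (g q : MvPolynomial (Fin d) ℝ) : Prop where
  factor : ∃ r ∈ PolyDeg d (k + 1), q = (∏ j ∈ Finset.univ.erase i, lam j ^ 2) * r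
  orthogonal : ∀ p ∈ PolyDeg d (k - 1), ∫ x in T.carrier, polyVal q x * polyVal p x = 0
  normal_deriv : ∀ p ∈ PolyDeg d k,
    ∫ x, polyDirDeriv q (T.normal i) x * polyVal p x ∂(T.surfaceMeasure i) = 0
  trace : ∀ p ∈ PolyDeg d (k + 1),
    ∫ x, (polyVal q x - polyVal g x) * polyVal p x ∂(T.surfaceMeasure i) = 0

end ConvexPolytope

end

noncomputable section

/-- A polynomial of degree at most `k` in one variable is extrapolated from `k + 1` nodes in
`(0, ε]` to the point `1`. -/
theorem Polynomial.exists_extrapolation (k : ℕ) {ε : ℝ} (hε : 0 < ε) :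
    ∃ c t : Fin (k + 1) → ℝ, (∀ i, 0 < t i ∧ t i ≤ ε) ∧
      ∀ P : Polynomial ℝ, P.natDegree ≤ k → P.eval 1 = ∑ i, c i * P.eval (t i) := by
  set t : Fin (k + 1) → ℝ := fun i => ε * (((i : ℕ) : ℝ) + 1) / (k + 1) with ht
  have hinj : Function.Injective t := by
    intro i j hij
    simp only [ht] at hij
    field_simp at hij
    exact Fin.ext (by exact_mod_cast add_right_cancel hij)
  refine ⟨fun i => (Lagrange.basis Finset.univ t i).eval 1, t, fun i => ⟨by positivity, ?_⟩, ?_⟩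
  · have hi : ((i : ℕ) : ℝ) + 1 ≤ k + 1 := by exact_mod_cast i.2
    simp only [ht]
    rw [div_le_iff₀ (by positivity)]
    gcongr
  · intro P hP
    have h := Lagrange.eq_interpolate (s := Finset.univ) (v := t) (f := P) (hinj.injOn)
      (lt_of_le_of_lt Polynomial.degree_le_natDegree (by
        rw [Finset.card_univ, Fintype.card_fin]; exact_mod_cast Nat.lt_succ_of_le hP))
    conv_lhs => rw [h]
    simp [Lagrange.interpolate_apply, Polynomial.eval_finsetSum, mul_comm]

/-- The restriction of `f` to every line is a polynomial of degree at most `k`. -/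
def IsPolyOnLines {E : Type*} [AddCommGroup E] [Module ℝ E] (k : ℕ) (f : E → ℝ) : Prop :=
  ∀ x v : E, ∃ P : Polynomial ℝ, P.natDegree ≤ k ∧ ∀ t : ℝ, f (x + t • v) = P.eval t

theorem IsPolyOnLines.exists_extrapolation (k : ℕ) {ε : ℝ} (hε : 0 < ε) :
    ∃ c t : Fin (k + 1) → ℝ, (∀ i, 0 < t i ∧ t i ≤ ε) ∧
      ∀ {E : Type} [AddCommGroup E] [Module ℝ E] (f : E → ℝ), IsPolyOnLines k f → ∀ m y : E,
        f y = ∑ i, c i * f (m + t i • (y - m)) := by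
  obtain ⟨c, t, ht, h⟩ := Polynomial.exists_extrapolation k hε
  refine ⟨c, t, ht, fun f hf m y => ?_⟩
  obtain ⟨P, hP, hPf⟩ := hf m (y - m)
  have := h P hP
  simp only [← hPf] at this
  simpa using this

theorem IsPolyOnLines.exists_sq_le_sum (k : ℕ) {ε : ℝ} (hε : 0 < ε) :
    ∃ (C : ℝ) (t : Fin (k + 1) → ℝ), 0 < C ∧ (∀ i, 0 < t i ∧ t i ≤ ε) ∧
      ∀ {E : Type} [AddCommGroup E] [Module ℝ E] (f : E → ℝ), IsPolyOnLines k f → ∀ m y : E,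
        f y ^ 2 ≤ C * ∑ i, f (m + t i • (y - m)) ^ 2 := by
  obtain ⟨c, t, ht, h⟩ := IsPolyOnLines.exists_extrapolation k hε
  refine ⟨∑ i, c i ^ 2 + 1, t, by positivity, ht, fun f hf m y => ?_⟩
  rw [h f hf m y]
  refine (Finset.sum_mul_sq_le_sq_mul_sq _ _ _).trans ?_
  gcongr
  linarith

/-- Extrapolation of a pointwise bound. -/
theorem IsPolyOnLines.exists_sq_le (k : ℕ) {ε : ℝ} (hε : 0 < ε) :
    ∃ C : ℝ, 0 < C ∧
      ∀ {E : Type} [AddCommGroup E] [Module ℝ E] (f : E → ℝ), IsPolyOnLines k f →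
        ∀ (m y : E) (M : ℝ), (∀ s : ℝ, 0 < s → s ≤ ε → f (m + s • (y - m)) ^ 2 ≤ M) →
          f y ^ 2 ≤ C * M := by
  obtain ⟨C, t, hC, ht, h⟩ := IsPolyOnLines.exists_sq_le_sum k hε
  refine ⟨C * (k + 1), by positivity, fun f hf m y M hM => (h f hf m y).trans ?_⟩
  rw [mul_assoc]
  gcongr
  calc ∑ i, f (m + t i • (y - m)) ^ 2 ≤ ∑ _i : Fin (k + 1), M :=
        Finset.sum_le_sum fun i _ => hM _ (ht i).1 (ht i).2
    _ = (k + 1) * M := by simp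

section Homothety

variable {N : ℕ}

theorem setIntegral_homothety_le {K L : Set (EuclideanSpace ℝ (Fin N))} (hK : MeasurableSet K)
    (hL : MeasurableSet L)
    (c : EuclideanSpace ℝ (Fin N)) {s : ℝ} (hs : 0 < s) {g : EuclideanSpace ℝ (Fin N) → ℝ}
    (hg : ∀ x, 0 ≤ g x) (hgi : IntegrableOn g L) (hKL : ∀ z ∈ K, c + s • (z - c) ∈ L) :
    ∫ z in K, g (c + s • (z - c)) ≤ (s ^ N)⁻¹ * ∫ x in L, g x := by
  set G := L.indicator g with hG
  have hGi : Integrable G := hgi.integrable_indicator hL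
  have e : ∀ z, c + s • (z - c) = s • z + (c - s • c) := fun z => by rw [smul_sub]; abel
  have hGi' : Integrable fun z => G (c + s • (z - c)) := by
    simp only [e]
    exact (hGi.comp_add_right (c - s • c)).comp_smul hs.ne'
  have h1 : ∫ z, G (c + s • (z - c)) = (s ^ N)⁻¹ * ∫ x in L, g x := by
    simp only [e]
    rw [Measure.integral_comp_smul volume (fun z => G (z + (c - s • c))) s,
      integral_add_right_eq_self, hG, integral_indicator hL, finrank_euclideanSpace_fin,
      abs_of_pos (by positivity), smul_eq_mul]
  rw [← h1, ← integral_indicator hK]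
  refine integral_mono_of_nonneg (Filter.Eventually.of_forall fun z =>
    Set.indicator_nonneg (fun z _ => hg _) z) hGi' (Filter.Eventually.of_forall fun z => ?_)
  by_cases hz : z ∈ K
  · simp [hG, hz, hKL z hz]
  · simp only [Set.indicator_of_notMem hz]
    exact Set.indicator_nonneg (fun z _ => hg _) _

/-- On polynomials, the `L²` norm with a weight that is bounded below on the copy of `K` shrunk by
the factor `1/2` dominates the `L²` norm on `K`. -/
theorem exists_integral_sq_le_weighted (N k : ℕ) :
    ∃ C : ℝ, 0 < C ∧ ∀ (K : Set (EuclideanSpace ℝ (Fin N))) (c : EuclideanSpace ℝ (Fin N))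
      (f w : EuclideanSpace ℝ (Fin N) → ℝ) (w₀ : ℝ), IsCompact K → Convex ℝ K → c ∈ K →
      IsPolyOnLines k f → Continuous f → Continuous w → (∀ x ∈ K, 0 ≤ w x) →
      (∀ x ∈ K, w₀ ≤ w (c + (1 / 2 : ℝ) • (x - c))) →
      w₀ * ∫ x in K, f x ^ 2 ≤ C * ∫ x in K, w x * f x ^ 2 := by
  obtain ⟨C, t, hC, ht, h⟩ := IsPolyOnLines.exists_sq_le_sum k (ε := 1 / 2) (by norm_num)
  refine ⟨C * ∑ i, (t i ^ N)⁻¹,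
    mul_pos hC (Finset.sum_pos (fun i _ => by have := (ht i).1; positivity) ⟨0, by simp⟩),
    fun K c f w w₀ hK hKc hcK hf hfc hwc hw0 hw => ?_⟩
  have hmem : ∀ (s : ℝ), 0 ≤ s → s ≤ 1 → ∀ x ∈ K, c + s • (x - c) ∈ K := fun s h0 h1 x hx =>
    hKc.add_smul_sub_mem hcK hx ⟨h0, h1⟩
  have hKm := hK.isClosed.measurableSet
  have hwf : IntegrableOn (fun x => w x * f x ^ 2) K :=
    (hwc.mul (hfc.pow 2)).continuousOn.integrableOn_compact hK
  have hi : ∀ i, w₀ * ∫ x in K, f (c + t i • (x - c)) ^ 2 ≤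
      (t i ^ N)⁻¹ * ∫ x in K, w x * f x ^ 2 := by
    intro i
    have h0 := (ht i).1
    have h1 := (ht i).2
    have hg : IntegrableOn (fun x => |w x| * f x ^ 2) K :=
      (hwc.abs.mul (hfc.pow 2)).continuousOn.integrableOn_compact hK
    have := setIntegral_homothety_le hKm hKm c h0 (g := fun x => |w x| * f x ^ 2)
      (fun x => by positivity) hg (hmem (t i) h0.le (by linarith))
    rw [← integral_const_mul]
    refine le_trans ?_ (this.trans_eq ?_)
    · refine setIntegral_mono_on ?_ ?_ hKm fun x hx => ?_
      · exact (Continuous.continuousOn (by fun_prop)).integrableOn_compact hK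
      · exact (Continuous.continuousOn (by fun_prop)).integrableOn_compact hK
      · gcongr
        refine le_trans ?_ (le_abs_self _)
        have := hw _ (hmem (2 * t i) (by positivity) (by linarith) x hx)
        simpa [smul_smul, ← mul_assoc] using this
    · congr 1
      exact setIntegral_congr_fun hKm fun x hx => by simp [abs_of_nonneg (hw0 x hx)]
  rcases le_or_gt w₀ 0 with hw₀ | hw₀
  · have h1 : 0 ≤ ∫ x in K, f x ^ 2 := integral_nonneg fun x => sq_nonneg _
    have h2 : 0 ≤ ∫ x in K, w x * f x ^ 2 :=
      setIntegral_nonneg hKm fun x hx => mul_nonneg (hw0 x hx) (sq_nonneg _)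
    have h3 : 0 ≤ ∑ i, (t i ^ N)⁻¹ := Finset.sum_nonneg fun i _ => by
      have := (ht i).1; positivity
    exact (mul_nonpos_of_nonpos_of_nonneg hw₀ h1).trans (by positivity)
  calc w₀ * ∫ x in K, f x ^ 2
      ≤ w₀ * ∫ x in K, C * ∑ i, f (c + t i • (x - c)) ^ 2 := by
        refine mul_le_mul_of_nonneg_left
          (setIntegral_mono_on ?_ ?_ hKm fun x hx => h f hf c x) hw₀.le
        · exact (hfc.pow 2).continuousOn.integrableOn_compact hK
        · exact (Continuous.continuousOn (by fun_prop)).integrableOn_compact hK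
    _ = C * ∑ i, w₀ * ∫ x in K, f (c + t i • (x - c)) ^ 2 := by
        rw [integral_const_mul, integral_finsetSum, ← Finset.mul_sum]
        · ring
        · intro i _
          exact (Continuous.continuousOn (by fun_prop)).integrableOn_compact hK
    _ ≤ C * ∑ i, (t i ^ N)⁻¹ * ∫ x in K, w x * f x ^ 2 := by
        exact mul_le_mul_of_nonneg_left (Finset.sum_le_sum fun i _ => hi i) hC.le
    _ = _ := by rw [← Finset.sum_mul, mul_assoc]

/-- The value of a polynomial at a point of a convex body is bounded by its `L²` mean. -/
theorem exists_volume_mul_sq_le (N k : ℕ) :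
    ∃ C : ℝ, 0 < C ∧ ∀ (K : Set (EuclideanSpace ℝ (Fin N)))
      (f : EuclideanSpace ℝ (Fin N) → ℝ), IsCompact K → Convex ℝ K →
      IsPolyOnLines k f → Continuous f → ∀ y ∈ K,
      volume.real K * f y ^ 2 ≤ C * ∫ x in K, f x ^ 2 := by
  obtain ⟨C, t, hC, ht, h⟩ := IsPolyOnLines.exists_sq_le_sum k (ε := 1 / 2) (by norm_num)
  have ht1 : ∀ i, 0 < 1 - t i := fun i => by have := (ht i).2; linarith
  refine ⟨C * ∑ i, ((1 - t i) ^ N)⁻¹,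
    mul_pos hC (Finset.sum_pos (fun i _ => by have := ht1 i; positivity) ⟨0, by simp⟩),
    fun K f hK hKc hf hfc y hy => ?_⟩
  have hKm := hK.isClosed.measurableSet
  have e : ∀ (s : ℝ) (z : EuclideanSpace ℝ (Fin N)),
      z + s • (y - z) = y + (1 - s) • (z - y) := fun s z => by module
  calc volume.real K * f y ^ 2 = ∫ _z in K, f y ^ 2 := by simp
    _ ≤ ∫ z in K, C * ∑ i, f (y + (1 - t i) • (z - y)) ^ 2 := by
        refine setIntegral_mono_on ?_ ?_ hKm fun z hz => ?_
        · exact continuousOn_const.integrableOn_compact hK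
        · exact (Continuous.continuousOn (by fun_prop)).integrableOn_compact hK
        · simpa only [e] using h f hf z y
    _ = C * ∑ i, ∫ z in K, f (y + (1 - t i) • (z - y)) ^ 2 := by
        rw [integral_const_mul, integral_finsetSum]
        intro i _
        exact (Continuous.continuousOn (by fun_prop)).integrableOn_compact hK
    _ ≤ C * ∑ i, ((1 - t i) ^ N)⁻¹ * ∫ x in K, f x ^ 2 := by
        gcongr with i
        refine setIntegral_homothety_le hKm hKm y (ht1 i) (g := fun x => f x ^ 2)
          (fun x => sq_nonneg _) ((hfc.pow 2).continuousOn.integrableOn_compact hK) fun z hz => ?_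
        exact hKc.add_smul_sub_mem hy hz ⟨(ht1 i).le, by have := (ht i).1; linarith⟩
    _ = _ := by rw [← Finset.sum_mul, mul_assoc]

end Homothety

/-- If `c ∫ a² ≤ ∫ b a`, then `c² ∫ a² ≤ ∫ b²`. -/
theorem sq_mul_integral_sq_le {X : Type*} [MeasurableSpace X] {μ : Measure X} {a b : X → ℝ} {c : ℝ}
    (hc : 0 ≤ c) (haa : Integrable (fun x => a x ^ 2) μ) (hbb : Integrable (fun x => b x ^ 2) μ)
    (hab : Integrable (fun x => b x * a x) μ)
    (h : c * ∫ x, a x ^ 2 ∂μ ≤ ∫ x, b x * a x ∂μ) :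
    c ^ 2 * ∫ x, a x ^ 2 ∂μ ≤ ∫ x, b x ^ 2 ∂μ := by
  have h1 : 0 ≤ ∫ x, (b x - c * a x) ^ 2 ∂μ := integral_nonneg fun x => sq_nonneg _
  have h2 : ∫ x, (b x - c * a x) ^ 2 ∂μ =
      ∫ x, b x ^ 2 ∂μ - 2 * c * ∫ x, b x * a x ∂μ + c ^ 2 * ∫ x, a x ^ 2 ∂μ := by
    have hba := hab.const_mul (2 * c)
    rw [← integral_const_mul, ← integral_const_mul, ← integral_sub hbb hba]
    refine Eq.trans ?_ (integral_add (hbb.sub hba) (haa.const_mul (c ^ 2)))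
    congr 1 with x
    ring
  nlinarith [mul_le_mul_of_nonneg_left h hc]

section PolyVal

variable {d : ℕ}

@[simp] theorem polyVal_zero (x : EuclideanSpace ℝ (Fin d)) : polyVal 0 x = 0 := map_zero _

@[simp] theorem polyVal_one (x : EuclideanSpace ℝ (Fin d)) : polyVal 1 x = 1 := map_one _

@[simp] theorem polyVal_C (a : ℝ) (x : EuclideanSpace ℝ (Fin d)) :
    polyVal (MvPolynomial.C a) x = a := MvPolynomial.eval_C _

@[simp] theorem polyVal_X (j : Fin d) (x : EuclideanSpace ℝ (Fin d)) :
    polyVal (MvPolynomial.X j) x = x j := MvPolynomial.eval_X _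

@[simp] theorem polyVal_add (p q : MvPolynomial (Fin d) ℝ) (x : EuclideanSpace ℝ (Fin d)) :
    polyVal (p + q) x = polyVal p x + polyVal q x := map_add _ _ _

@[simp] theorem polyVal_sub (p q : MvPolynomial (Fin d) ℝ) (x : EuclideanSpace ℝ (Fin d)) :
    polyVal (p - q) x = polyVal p x - polyVal q x := map_sub _ _ _

@[simp] theorem polyVal_neg (p : MvPolynomial (Fin d) ℝ) (x : EuclideanSpace ℝ (Fin d)) :
    polyVal (-p) x = -polyVal p x := map_neg _ _

@[simp] theorem polyVal_mul (p q : MvPolynomial (Fin d) ℝ) (x : EuclideanSpace ℝ (Fin d)) :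
    polyVal (p * q) x = polyVal p x * polyVal q x := map_mul _ _ _

@[simp] theorem polyVal_smul (a : ℝ) (p : MvPolynomial (Fin d) ℝ)
    (x : EuclideanSpace ℝ (Fin d)) : polyVal (a • p) x = a * polyVal p x := by
  simp [MvPolynomial.smul_eq_C_mul]

@[simp] theorem polyVal_pow (p : MvPolynomial (Fin d) ℝ) (m : ℕ)
    (x : EuclideanSpace ℝ (Fin d)) : polyVal (p ^ m) x = polyVal p x ^ m := map_pow _ _ _

@[simp] theorem polyVal_sum {ι : Type*} (s : Finset ι) (p : ι → MvPolynomial (Fin d) ℝ)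
    (x : EuclideanSpace ℝ (Fin d)) : polyVal (∑ i ∈ s, p i) x = ∑ i ∈ s, polyVal (p i) x :=
  map_sum _ _ _

@[simp] theorem polyVal_prod {ι : Type*} (s : Finset ι) (p : ι → MvPolynomial (Fin d) ℝ)
    (x : EuclideanSpace ℝ (Fin d)) : polyVal (∏ i ∈ s, p i) x = ∏ i ∈ s, polyVal (p i) x :=
  map_prod _ _ _

@[fun_prop]
theorem continuous_polyVal (p : MvPolynomial (Fin d) ℝ) : Continuous (polyVal p) := by
  unfold polyVal
  exact (MvPolynomial.continuous_eval p).comp (PiLp.continuous_ofLp 2 _)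

theorem polyVal_injective : Function.Injective (polyVal (d := d)) := fun _ _ h =>
  MvPolynomial.funext fun x => congrFun h (WithLp.toLp 2 x)

theorem isPolyOnLines_polyVal {k : ℕ} {p : MvPolynomial (Fin d) ℝ} (hp : p.totalDegree ≤ k) :
    IsPolyOnLines k (polyVal p) := by
  intro x v
  refine ⟨MvPolynomial.aeval (fun j => Polynomial.C (x j) + Polynomial.C (v j) * Polynomial.X) p,
    ?_, fun t => ?_⟩
  · refine (MvPolynomial.aeval_natDegree_le (m := k) (n := 1) p hp _ fun j => ?_).trans (by simp)
    refine (Polynomial.natDegree_add_le _ _).trans (max_le (by simp) ?_)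
    exact (Polynomial.natDegree_C_mul_le _ _).trans Polynomial.natDegree_X_le
  · clear hp
    induction p using MvPolynomial.induction_on with
    | C a => simp
    | add p q hp hq => simp [hp, hq]
    | mul_X p j hp =>
      rw [polyVal_mul, hp, map_mul, Polynomial.eval_mul]
      congr 1
      simp [mul_comm t]

theorem polyVal_lineMap {p : MvPolynomial (Fin d) ℝ} (hp : p.totalDegree ≤ 1)
    (x y : EuclideanSpace ℝ (Fin d)) (t : ℝ) :
    polyVal p (x + t • (y - x)) = (1 - t) * polyVal p x + t * polyVal p y := by
  obtain ⟨P, hP, h⟩ := isPolyOnLines_polyVal hp x (y - x)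
  obtain ⟨a, b, rfl⟩ := Polynomial.exists_eq_X_add_C_of_natDegree_le_one hP
  have h0 := h 0
  have h1 := h 1
  have ht := h t
  simp at h0 h1 ht
  rw [h0, h1, ht]
  ring

/-- The directional derivative of polynomials as a derivation. -/
def polyDeriv (v : EuclideanSpace ℝ (Fin d)) :
    Derivation ℝ (MvPolynomial (Fin d) ℝ) (MvPolynomial (Fin d) ℝ) :=
  MvPolynomial.mkDerivation ℝ fun j => MvPolynomial.C (v j)

theorem polyVal_polyDeriv (v : EuclideanSpace ℝ (Fin d)) (p : MvPolynomial (Fin d) ℝ)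
    (x : EuclideanSpace ℝ (Fin d)) : polyVal (polyDeriv v p) x = polyDirDeriv p v x := by
  have hX : ∀ j, polyDeriv v (MvPolynomial.X j) = MvPolynomial.C (v j) := fun j =>
    MvPolynomial.mkDerivation_X _ _ _
  induction p using MvPolynomial.induction_on with
  | C a => simp [polyDirDeriv, ← MvPolynomial.algebraMap_eq]
  | add p q hp hq => simp [polyDirDeriv, hp, hq, add_mul, Finset.sum_add_distrib]
  | mul_X p j hp =>
    have h1 : ∀ i, polyVal (MvPolynomial.pderiv i (p * MvPolynomial.X j)) x * v i =
        polyVal p x * (if i = j then v i else 0) +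
          x j * (polyVal (MvPolynomial.pderiv i p) x * v i) := by
      intro i
      rw [Derivation.leibniz, MvPolynomial.pderiv_X]
      by_cases h : i = j
      · subst h; simp; ring
      · simp [h]; ring
    rw [polyDirDeriv, Finset.sum_congr rfl fun i _ => h1 i, Finset.sum_add_distrib,
      ← Finset.mul_sum, ← Finset.mul_sum, Derivation.leibniz, hX]
    simp [hp, polyDirDeriv]

/-- The polynomial `x ↦ b + ⟪u, x⟫`. -/
def affPoly (b : ℝ) (u : EuclideanSpace ℝ (Fin d)) : MvPolynomial (Fin d) ℝ :=
  MvPolynomial.C b + ∑ j, MvPolynomial.C (u j) * MvPolynomial.X j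

@[simp] theorem polyVal_affPoly (b : ℝ) (u x : EuclideanSpace ℝ (Fin d)) :
    polyVal (affPoly b u) x = b + inner ℝ u x := by
  simp [affPoly, PiLp.inner_apply, mul_comm]

theorem polyDeriv_affPoly (b : ℝ) (u v : EuclideanSpace ℝ (Fin d)) :
    polyDeriv v (affPoly b u) = MvPolynomial.C (inner ℝ u v) := by
  simp [affPoly, polyDeriv, PiLp.inner_apply, mul_comm]

theorem totalDegree_affPoly_le (b : ℝ) (u : EuclideanSpace ℝ (Fin d)) :
    (affPoly b u).totalDegree ≤ 1 := by
  refine (MvPolynomial.totalDegree_add _ _).trans (max_le (by simp) ?_)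
  refine MvPolynomial.totalDegree_finsetSum_le fun j _ => ?_
  exact (MvPolynomial.totalDegree_mul _ _).trans (by simp)

theorem totalDegree_bind₁_le {f : Fin d → MvPolynomial (Fin d) ℝ} (hf : ∀ j, (f j).totalDegree ≤ 1)
    (p : MvPolynomial (Fin d) ℝ) : (MvPolynomial.bind₁ f p).totalDegree ≤ p.totalDegree := by
  conv_lhs => rw [p.as_sum, map_sum]
  refine MvPolynomial.totalDegree_finsetSum_le fun s hs => ?_
  rw [MvPolynomial.bind₁_monomial]
  refine (MvPolynomial.totalDegree_mul _ _).trans ?_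
  rw [MvPolynomial.totalDegree_C, zero_add]
  refine ((MvPolynomial.totalDegree_finsetProd _ _).trans (Finset.sum_le_sum fun j _ => ?_)).trans
    (MvPolynomial.le_totalDegree hs)
  refine (MvPolynomial.totalDegree_pow _ _).trans ?_
  exact (Nat.mul_le_mul_left _ (hf j)).trans (by simp)

section Projection

variable (b : ℝ) (u : EuclideanSpace ℝ (Fin d))

/-- Composition with the projection `x ↦ x - (b + ⟪u, x⟫) u`. -/
def projPoly : MvPolynomial (Fin d) ℝ →ₐ[ℝ] MvPolynomial (Fin d) ℝ :=
  MvPolynomial.bind₁ fun j => MvPolynomial.X j - MvPolynomial.C (u j) * affPoly b u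

theorem polyVal_projPoly (p : MvPolynomial (Fin d) ℝ) (x : EuclideanSpace ℝ (Fin d)) :
    polyVal (projPoly b u p) x = polyVal p (x - (b + inner ℝ u x) • u) := by
  induction p using MvPolynomial.induction_on with
  | C a => simp [projPoly]
  | add p q hp hq => simp [hp, hq]
  | mul_X p j hp =>
    rw [map_mul, polyVal_mul, hp, polyVal_mul]
    simp [projPoly, mul_comm]

theorem totalDegree_projPoly_X_le (j : Fin d) :
    (projPoly b u (MvPolynomial.X j)).totalDegree ≤ 1 := by
  rw [projPoly, MvPolynomial.bind₁_X_right]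
  refine (MvPolynomial.totalDegree_sub _ _).trans (max_le (by simp) ?_)
  refine (MvPolynomial.totalDegree_mul _ _).trans ?_
  simpa using totalDegree_affPoly_le b u

theorem totalDegree_projPoly_le (p : MvPolynomial (Fin d) ℝ) :
    (projPoly b u p).totalDegree ≤ p.totalDegree :=
  totalDegree_bind₁_le (fun j => by
    simpa [projPoly] using totalDegree_projPoly_X_le b u j) p

variable {u}

theorem polyDeriv_projPoly (hu : ‖u‖ = 1) (p : MvPolynomial (Fin d) ℝ) :
    polyDeriv u (projPoly b u p) = 0 := by
  induction p using MvPolynomial.induction_on with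
  | C a => rw [← MvPolynomial.algebraMap_eq, AlgHom.commutes, Derivation.map_algebraMap]
  | add p q hp hq => simp [hp, hq]
  | mul_X p j hp =>
    rw [map_mul, Derivation.leibniz, hp]
    simp [projPoly, polyDeriv_affPoly, hu, Derivation.leibniz]
    simp [polyDeriv]

theorem exists_eq_projPoly_add_mul_X {m : ℕ} {p : MvPolynomial (Fin d) ℝ}
    (hp : p.totalDegree ≤ m + 1)
    (h : ∃ q : MvPolynomial (Fin d) ℝ, q.totalDegree ≤ m ∧
      p = projPoly b u p + affPoly b u * q) (j : Fin d) :
    ∃ q : MvPolynomial (Fin d) ℝ, q.totalDegree ≤ m + 1 ∧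
      p * MvPolynomial.X j = projPoly b u (p * MvPolynomial.X j) + affPoly b u * q := by
  obtain ⟨q, hq, hpq⟩ := h
  refine ⟨projPoly b u (MvPolynomial.X j) * q + MvPolynomial.C (u j) * p, ?_, ?_⟩
  · refine (MvPolynomial.totalDegree_add _ _).trans (max_le ?_ ?_)
    · exact (MvPolynomial.totalDegree_mul _ _).trans
        ((add_le_add (totalDegree_projPoly_X_le b u j) hq).trans (add_comm _ _).le)
    · exact (MvPolynomial.totalDegree_mul _ _).trans (by simpa using hp)
  · have h1 : projPoly b u (MvPolynomial.X j) =
        MvPolynomial.X j - MvPolynomial.C (u j) * affPoly b u := by simp [projPoly]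
    rw [map_mul, h1]
    linear_combination (MvPolynomial.X j - MvPolynomial.C (u j) * affPoly b u) * hpq

theorem exists_eq_projPoly_add_monomial (m : ℕ) (s : Fin d →₀ ℕ)
    (hs : (s.sum fun _ e => e) ≤ m + 1) :
    ∃ q : MvPolynomial (Fin d) ℝ, q.totalDegree ≤ m ∧
      MvPolynomial.monomial s 1 = projPoly b u (MvPolynomial.monomial s 1) + affPoly b u * q := by
  induction m generalizing s with
  | zero =>
    by_cases h0 : s = 0
    · exact ⟨0, by simp, by simp [h0]⟩
    obtain ⟨j, hj⟩ := Finsupp.ne_iff.1 h0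
    obtain ⟨s, rfl⟩ : ∃ s', s = s' + Finsupp.single j 1 :=
      ⟨_, (tsub_add_cancel_of_le (by simpa using Nat.one_le_iff_ne_zero.2 hj)).symm⟩
    rw [Finsupp.sum_add_index' (by simp) (by simp)] at hs
    have hs0 : s = 0 := by
      have : s.sum (fun _ e => e) = 0 := by simpa using hs
      ext i
      by_contra hi
      exact hi (Finset.sum_eq_zero_iff.1 this i (Finsupp.mem_support_iff.2 hi))
    refine ⟨MvPolynomial.C (u j), by simp, ?_⟩
    simp only [hs0, zero_add, projPoly]
    change MvPolynomial.X j = MvPolynomial.bind₁ _ (MvPolynomial.X j) + _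
    rw [MvPolynomial.bind₁_X_right]
    ring
  | succ m ih =>
    by_cases h0 : s = 0
    · exact ⟨0, by simp, by simp [h0]⟩
    obtain ⟨j, hj⟩ := Finsupp.ne_iff.1 h0
    obtain ⟨s, rfl⟩ : ∃ s', s = s' + Finsupp.single j 1 :=
      ⟨_, (tsub_add_cancel_of_le (by simpa using Nat.one_le_iff_ne_zero.2 hj)).symm⟩
    rw [Finsupp.sum_add_index' (by simp) (by simp)] at hs
    have hs' : s.sum (fun _ e => e) ≤ m + 1 := by simpa using hs
    rw [MvPolynomial.monomial_add_single, pow_one]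
    exact exists_eq_projPoly_add_mul_X b
      ((MvPolynomial.totalDegree_monomial_le _ _).trans hs') (ih s hs') j

/-- Division with remainder by the affine polynomial of a hyperplane; the remainder is constant
along the normal direction. -/
theorem exists_eq_projPoly_add {m : ℕ} {p : MvPolynomial (Fin d) ℝ} (hp : p.totalDegree ≤ m + 1) :
    ∃ q : MvPolynomial (Fin d) ℝ, q.totalDegree ≤ m ∧ p = projPoly b u p + affPoly b u * q := by
  have h : ∀ s : Fin d →₀ ℕ, ∃ q : MvPolynomial (Fin d) ℝ, s ∈ p.support → q.totalDegree ≤ m ∧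
      MvPolynomial.monomial s 1 =
        projPoly b u (MvPolynomial.monomial s 1) + affPoly b u * q := by
    intro s
    by_cases hs : s ∈ p.support
    · obtain ⟨q, hq⟩ := exists_eq_projPoly_add_monomial b (u := u) m s
        ((MvPolynomial.le_totalDegree hs).trans hp)
      exact ⟨q, fun _ => hq⟩
    · exact ⟨0, fun h => absurd h hs⟩
  choose q hq using h
  refine ⟨∑ s ∈ p.support, p.coeff s • q s, ?_, ?_⟩
  · exact MvPolynomial.totalDegree_finsetSum_le fun s hs =>
      (MvPolynomial.totalDegree_smul_le _ _).trans (hq s hs).1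
  · have h1 : p = ∑ s ∈ p.support, p.coeff s • MvPolynomial.monomial s (1 : ℝ) := by
      conv_lhs => rw [p.as_sum]
      exact Finset.sum_congr rfl fun s _ => by simp [MvPolynomial.smul_monomial]
    conv_rhs => rw [Finset.mul_sum]
    conv_lhs => rw [h1]
    conv_rhs => enter [1]; rw [h1, map_sum]
    rw [← Finset.sum_add_distrib]
    refine Finset.sum_congr rfl fun s hs => ?_
    conv_lhs => rw [(hq s hs).2]
    rw [map_smul, smul_add, mul_smul_comm]

end Projection

end PolyVal

namespace ConvexPolytope

variable {d n : ℕ}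

/-- The signed distance of `x` to the hyperplane of the `j`-th facet, positive inside. -/
def gap (T : ConvexPolytope d n) (j : Fin n) (x : EuclideanSpace ℝ (Fin d)) : ℝ :=
  T.offset j - inner ℝ (T.normal j) x

variable (T : ConvexPolytope d n) (i j : Fin n)

theorem gap_add (x v : EuclideanSpace ℝ (Fin d)) :
    T.gap j (x + v) = T.gap j x - inner ℝ (T.normal j) v := by
  simp only [gap, inner_add_right]; ring

theorem gap_add_smul_sub (x y : EuclideanSpace ℝ (Fin d)) (t : ℝ) :
    T.gap j (x + t • (y - x)) = (1 - t) * T.gap j x + t * T.gap j y := by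
  simp only [gap, inner_add_right, inner_sub_right, inner_smul_right]; ring

@[fun_prop]
theorem continuous_gap : Continuous (T.gap j) := by unfold gap; fun_prop

theorem mem_carrier_iff {x : EuclideanSpace ℝ (Fin d)} :
    x ∈ T.carrier ↔ ∀ j, 0 ≤ T.gap j x := by simp [carrier, gap]

theorem mem_face_iff {x : EuclideanSpace ℝ (Fin d)} :
    x ∈ T.face i ↔ (∀ j, 0 ≤ T.gap j x) ∧ T.gap i x = 0 := by
  rw [face, Set.mem_ofPred_eq, mem_carrier_iff, gap, sub_eq_zero, eq_comm (a := inner ℝ _ _)]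

theorem face_subset_carrier : T.face i ⊆ T.carrier := fun _ hx => hx.1

theorem isCompact_carrier : IsCompact T.carrier := by
  refine Metric.isCompact_of_isClosed_isBounded ?_ T.bounded
  have : T.carrier = ⋂ j, {x | 0 ≤ T.gap j x} := by ext x; simp [mem_carrier_iff]
  rw [this]
  exact isClosed_iInter fun j => isClosed_le continuous_const (T.continuous_gap j)

theorem isCompact_face : IsCompact (T.face i) := by
  refine T.isCompact_carrier.of_isClosed_subset ?_ (T.face_subset_carrier i)
  have : T.face i = T.carrier ∩ {x | T.gap i x = 0} := by
    ext x; simp [mem_carrier_iff, mem_face_iff]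
  rw [this]
  exact T.isCompact_carrier.isClosed.inter (isClosed_eq (T.continuous_gap i) continuous_const)

theorem convex_carrier : Convex ℝ T.carrier := by
  refine convex_iff_add_mem.2 fun x hx y hy a b ha hb hab => ?_
  rw [mem_carrier_iff] at *
  intro j
  have : T.gap j (a • x + b • y) = a * T.gap j x + b * T.gap j y := by
    simp only [gap, inner_add_right, inner_smul_right]; linear_combination (-T.offset j) * hab
  rw [this]
  exact add_nonneg (mul_nonneg ha (hx j)) (mul_nonneg hb (hy j))

theorem convex_face : Convex ℝ (T.face i) := by
  refine convex_iff_add_mem.2 fun x hx y hy a b ha hb hab => ?_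
  refine (T.mem_face_iff i).2 ⟨(T.mem_carrier_iff).1 (T.convex_carrier hx.1 hy.1 ha hb hab), ?_⟩
  have : T.gap i (a • x + b • y) = a * T.gap i x + b * T.gap i y := by
    simp only [gap, inner_add_right, inner_smul_right]; linear_combination (-T.offset i) * hab
  rw [this, ((T.mem_face_iff i).1 hx).2, ((T.mem_face_iff i).1 hy).2]
  simp

theorem exists_gap_eq_zero : ∃ x, T.gap i x = 0 ∧ ∀ j, j ≠ i → 0 < T.gap j x := by
  obtain ⟨x, hx, h⟩ := T.irredundant i
  exact ⟨x, by simp [gap, hx], fun j hj => by simpa [gap] using h j hj⟩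

/-- An isometric parametrization of the hyperplane of the `i`-th facet that starts in the relative
interior of the facet. -/
structure FacetChart (T : ConvexPolytope d n) (i : Fin n) where
  base : EuclideanSpace ℝ (Fin d)
  dir : EuclideanSpace ℝ (Fin (d - 1)) →ₗᵢ[ℝ] EuclideanSpace ℝ (Fin d)
  gap_base : T.gap i base = 0
  gap_base_pos : ∀ j, j ≠ i → 0 < T.gap j base
  inner_dir : ∀ y, inner ℝ (T.normal i) (dir y) = 0
  exists_dir_eq : ∀ v, inner ℝ (T.normal i) v = 0 → ∃ y, dir y = v

theorem nonempty_facetChart (hd : 1 ≤ d) : Nonempty (FacetChart T i) := by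
  obtain ⟨x, hx, hpos⟩ := T.exists_gap_eq_zero i
  have hn : T.normal i ≠ 0 := by
    intro h
    have := T.norm_normal i
    simp [h] at this
  have : Fact (Module.finrank ℝ (EuclideanSpace ℝ (Fin d)) = (d - 1) + 1) :=
    ⟨by rw [finrank_euclideanSpace_fin]; omega⟩
  let B := OrthonormalBasis.fromOrthogonalSpanSingleton (𝕜 := ℝ) (d - 1) hn
  refine ⟨⟨x, (Submodule.subtypeₗᵢ _).comp B.repr.symm.toLinearIsometry, hx, hpos, ?_, ?_⟩⟩
  · intro y
    exact Submodule.mem_orthogonal_singleton_iff_inner_right.1 (B.repr.symm y).2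
  · intro v hv
    exact ⟨B.repr ⟨v, Submodule.mem_orthogonal_singleton_iff_inner_right.2 hv⟩, by simp⟩

namespace FacetChart

variable {T i} (c : FacetChart T i)

/-- The parametrization as a map. -/
def map (y : EuclideanSpace ℝ (Fin (d - 1))) : EuclideanSpace ℝ (Fin d) := c.base + c.dir y

/-- The parameter domain of the facet. -/
def dom : Set (EuclideanSpace ℝ (Fin (d - 1))) := c.map ⁻¹' T.face i

theorem isometry_map : Isometry c.map :=
  (IsometryEquiv.addLeft c.base).isometry.comp c.dir.isometry

@[fun_prop]
theorem continuous_map : Continuous c.map := c.isometry_map.continuous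

theorem isClosedEmbedding_map : Topology.IsClosedEmbedding c.map :=
  c.isometry_map.isClosedEmbedding

theorem map_add_smul_sub (x y : EuclideanSpace ℝ (Fin (d - 1))) (t : ℝ) :
    c.map (x + t • (y - x)) = c.map x + t • (c.map y - c.map x) := by
  simp only [map, map_add, map_smul, map_sub]
  module

theorem gap_map (y : EuclideanSpace ℝ (Fin (d - 1))) : T.gap i (c.map y) = 0 := by
  rw [map, gap_add, c.gap_base, c.inner_dir, sub_zero]

theorem exists_map_eq {x : EuclideanSpace ℝ (Fin d)} (hx : T.gap i x = 0) : ∃ y, c.map y = x := by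
  obtain ⟨y, hy⟩ := c.exists_dir_eq (x - c.base) (by
    have h1 := c.gap_base
    rw [gap] at hx h1
    rw [inner_sub_right]
    linarith)
  exact ⟨y, by rw [map, hy]; abel⟩

theorem isCompact_dom : IsCompact c.dom :=
  c.isClosedEmbedding_map.isCompact_preimage (T.isCompact_face i)

theorem convex_dom : Convex ℝ c.dom := by
  refine convex_iff_add_mem.2 fun x (hx : c.map x ∈ T.face i) y (hy : c.map y ∈ T.face i)
    a b ha hb hab => ?_
  have : c.map (a • x + b • y) = a • c.map x + b • c.map y := by
    simp only [map, map_add, map_smul]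
    rw [show b = 1 - a by linarith]
    module
  change c.map _ ∈ T.face i
  rw [this]
  exact T.convex_face i hx hy ha hb hab

theorem surfaceMeasure_eq : T.surfaceMeasure i = (volume.restrict c.dom).map c.map := by
  have h : T.face i ⊆ Set.range c.map := fun x hx => c.exists_map_eq ((T.mem_face_iff i).1 hx).2
  rw [dom, ← c.isClosedEmbedding_map.measurableEmbedding.restrict_map,
    ← EuclideanSpace.euclideanHausdorffMeasure_eq_volume,
    c.isometry_map.map_euclideanHausdorffMeasure,
    Measure.restrict_restrict (T.isCompact_face i).isClosed.measurableSet,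
    Set.inter_eq_left.2 h, surfaceMeasure]

theorem integral_surfaceMeasure {F : Type*} [NormedAddCommGroup F] [NormedSpace ℝ F]
    (f : EuclideanSpace ℝ (Fin d) → F) :
    ∫ x, f x ∂(T.surfaceMeasure i) = ∫ y in c.dom, f (c.map y) := by
  rw [c.surfaceMeasure_eq, c.isClosedEmbedding_map.measurableEmbedding.integral_map]

theorem integrable_surfaceMeasure (c : FacetChart T i) {F : Type*} [NormedAddCommGroup F]
    {f : EuclideanSpace ℝ (Fin d) → F} (hf : Continuous f) :
    Integrable f (T.surfaceMeasure i) := by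
  rw [c.surfaceMeasure_eq, c.isClosedEmbedding_map.measurableEmbedding.integrable_map_iff]
  exact (hf.comp c.continuous_map).continuousOn.integrableOn_compact c.isCompact_dom

theorem mem_dom_of_gap_pos {y : EuclideanSpace ℝ (Fin (d - 1))}
    (hy : ∀ j, j ≠ i → 0 < T.gap j (c.map y)) : y ∈ c.dom := by
  refine (T.mem_face_iff i).2 ⟨fun j => ?_, c.gap_map y⟩
  by_cases h : j = i
  · rw [h, c.gap_map]
  · exact (hy j h).le

theorem isOpen_gap_pos : IsOpen {y | ∀ j, j ≠ i → 0 < T.gap j (c.map y)} := by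
  simp only [Set.ofPred_forall]
  refine isOpen_iInter_of_finite fun j => isOpen_iInter_of_finite fun _ =>
    isOpen_lt continuous_const (by fun_prop)

theorem volume_dom_pos : 0 < volume.real c.dom := by
  refine ENNReal.toReal_pos (fun h => ?_) c.isCompact_dom.measure_lt_top.ne
  refine (c.isOpen_gap_pos.measure_pos volume ⟨0, ?_⟩).ne'
    (measure_mono_null (fun y hy => c.mem_dom_of_gap_pos hy) h)
  simpa [map] using c.gap_base_pos

theorem measureReal_surfaceMeasure : (T.surfaceMeasure i).real Set.univ = volume.real c.dom := by
  rw [c.surfaceMeasure_eq, map_measureReal_apply c.continuous_map.measurable MeasurableSet.univ]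
  simp

theorem volume_mul_gap_faceBarycenter (j : Fin n) :
    volume.real c.dom * T.gap j (T.faceBarycenter i) = ∫ y in c.dom, T.gap j (c.map y) := by
  have : IsFiniteMeasure (T.surfaceMeasure i) := by
    rw [c.surfaceMeasure_eq]
    have : IsFiniteMeasure (volume.restrict c.dom) :=
      ⟨by simpa using c.isCompact_dom.measure_lt_top⟩
    infer_instance
  have h1 : volume.real c.dom • T.faceBarycenter i = ∫ x, x ∂(T.surfaceMeasure i) := by
    rw [← c.measureReal_surfaceMeasure, faceBarycenter, measure_smul_average]
  rw [← c.integral_surfaceMeasure (T.gap j)]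
  have h2 : ∫ x, T.gap j x ∂(T.surfaceMeasure i) =
      volume.real c.dom * T.offset j - inner ℝ (T.normal j) (∫ x, x ∂(T.surfaceMeasure i)) := by
    unfold gap
    rw [integral_sub (integrable_const _) (c.integrable_surfaceMeasure (by fun_prop)),
      integral_inner (f := fun x => x) (c.integrable_surfaceMeasure continuous_id), integral_const,
      c.measureReal_surfaceMeasure, smul_eq_mul]
  rw [h2, ← h1, inner_smul_right, gap]
  ring

end FacetChart

theorem gap_faceBarycenter_self (hd : 1 ≤ d) : T.gap i (T.faceBarycenter i) = 0 := by
  obtain ⟨c⟩ := T.nonempty_facetChart i hd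
  have h := c.volume_mul_gap_faceBarycenter i
  simp only [c.gap_map, integral_zero] at h
  exact (mul_eq_zero.1 h).resolve_left c.volume_dom_pos.ne'

theorem gap_faceBarycenter_pos (hd : 1 ≤ d) {i j : Fin n} (hj : j ≠ i) :
    0 < T.gap j (T.faceBarycenter i) := by
  obtain ⟨c⟩ := T.nonempty_facetChart i hd
  have h := c.volume_mul_gap_faceBarycenter j
  refine pos_of_mul_pos_right (a := volume.real c.dom) (h ▸ ?_) c.volume_dom_pos.le
  have hm := c.isCompact_dom.isClosed.measurableSet
  rw [setIntegral_pos_iff_support_of_nonneg_ae]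
  · refine (c.isOpen_gap_pos.measure_pos volume ⟨0, ?_⟩).trans_le (measure_mono fun y hy => ?_)
    · simpa [FacetChart.map] using c.gap_base_pos
    · exact ⟨(hy j hj).ne', c.mem_dom_of_gap_pos hy⟩
  · exact (ae_restrict_iff' hm).2 (Filter.Eventually.of_forall fun y hy =>
      ((T.mem_face_iff i).1 hy).1 j)
  · exact Continuous.continuousOn (by fun_prop) |>.integrableOn_compact c.isCompact_dom

theorem faceBarycenter_mem_face (hd : 1 ≤ d) : T.faceBarycenter i ∈ T.face i := by
  refine (T.mem_face_iff i).2 ⟨fun j => ?_, T.gap_faceBarycenter_self i hd⟩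
  by_cases h : j = i
  · rw [h, T.gap_faceBarycenter_self i hd]
  · exact (T.gap_faceBarycenter_pos hd h).le

/-- The weights are the normalized distances to the hyperplanes of the facets. -/
theorem IsWeightFamily.polyVal_eq {T : ConvexPolytope d n} {i : Fin n}
    {lam : Fin n → MvPolynomial (Fin d) ℝ} (h : T.IsWeightFamily i lam) (hd : 1 ≤ d) {j : Fin n}
    (hj : j ≠ i) (x : EuclideanSpace ℝ (Fin d)) :
    polyVal (lam j) x = T.gap j x / T.gap j (T.faceBarycenter i) := by
  obtain ⟨hdeg, hface, hm⟩ := h j hj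
  have hdeg := (MvPolynomial.mem_restrictTotalDegree _ _ _).1 hdeg
  set m := T.faceBarycenter i
  have hpos : 0 < T.gap j m := T.gap_faceBarycenter_pos hd hj
  obtain ⟨x₀, hx₀, hx₀'⟩ := T.exists_gap_eq_zero j
  have hx₀f : x₀ ∈ T.face j := (T.mem_face_iff j).2 ⟨fun l => by
    by_cases h : l = j
    · rw [h, hx₀]
    · exact (hx₀' l h).le, hx₀⟩
  have hplane : ∀ z, T.gap j z = 0 → polyVal (lam j) z = 0 := by
    intro z hz
    have hev : ∀ᶠ t in nhds (0 : ℝ), ∀ l, l ≠ j → 0 < T.gap l (x₀ + t • (z - x₀)) := by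
      refine Filter.eventually_all.2 fun l => Filter.eventually_imp_distrib_left.2 fun hl => ?_
      have hc : Continuous fun t : ℝ => T.gap l (x₀ + t • (z - x₀)) := by fun_prop
      exact hc.continuousAt.eventually (lt_mem_nhds (by simpa using hx₀' l hl))
    obtain ⟨t, ht, ht0⟩ := ((hev.filter_mono nhdsWithin_le_nhds).and
      (self_mem_nhdsWithin : Set.Ioi (0 : ℝ) ∈ nhdsWithin 0 (Set.Ioi 0))).exists
    have hmem : x₀ + t • (z - x₀) ∈ T.face j := (T.mem_face_iff j).2
      ⟨fun l => by
        by_cases h : l = j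
        · rw [h, gap_add_smul_sub, hx₀, hz]; simp
        · exact (ht l h).le, by rw [gap_add_smul_sub, hx₀, hz]; simp⟩
    have := hface _ hmem
    rw [polyVal_lineMap hdeg, hface _ hx₀f, mul_zero, zero_add] at this
    exact (mul_eq_zero.1 this).resolve_left (ne_of_gt ht0)
  rw [eq_div_iff hpos.ne']
  have hne : ∀ z, T.gap j m ≠ T.gap j z → polyVal (lam j) z * T.gap j m = T.gap j z := by
    intro z hz
    have hne : T.gap j m - T.gap j z ≠ 0 := sub_ne_zero.2 hz
    have h1 := hplane (m + (T.gap j m / (T.gap j m - T.gap j z)) • (z - m)) (by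
      rw [gap_add_smul_sub]; field_simp; ring)
    rw [polyVal_lineMap hdeg, hm] at h1
    field_simp at h1
    linarith
  by_cases hx : T.gap j m = T.gap j x
  · have h1 := hne (x + (1 / 2 : ℝ) • (x₀ - x)) (by
      rw [gap_add_smul_sub, hx₀]; intro h; linarith)
    rw [polyVal_lineMap hdeg, gap_add_smul_sub, hx₀, hface _ hx₀f] at h1
    linarith
  · exact hne x hx

end ConvexPolytope

namespace ConvexPolytope

variable {d n : ℕ} (T : ConvexPolytope d n) (i : Fin n)

/-- A point of the facet can be chosen off all proper hyperplanes out of finitely many. -/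
theorem FacetChart.exists_generic {T : ConvexPolytope d n} {i : Fin n} (c : FacetChart T i)
    {ι : Type} [Finite ι] (F : ι → EuclideanSpace ℝ (Fin (d - 1)) → ℝ) (hF : ∀ a, Continuous (F a))
    (hlin : ∀ a y y' (t : ℝ), F a (y + t • (y' - y)) = (1 - t) * F a y + t * F a y') :
    ∃ y, (∀ j, j ≠ i → 0 < T.gap j (c.map y)) ∧ ∀ a, F a y = 0 → ∀ y', F a y' = 0 := by
  have hdense : Dense (⋂ a, {y | (∃ y', F a y' ≠ 0) → F a y ≠ 0}) := by
    refine dense_iInter_of_isOpen (fun a => ?_) fun a => ?_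
    · by_cases h : ∃ y', F a y' ≠ 0
      · simpa only [h, true_imp_iff] using isOpen_ne_fun (hF a) continuous_const
      · simp [h]
    · by_cases h : ∃ y', F a y' ≠ 0
      · obtain ⟨y', hy'⟩ := h
        have h : ∃ y', F a y' ≠ 0 := ⟨y', hy'⟩
        simp only [h, true_imp_iff]
        intro y
        by_cases hy : F a y = 0
        · have hc : Continuous fun t : ℝ => y + t • (y' - y) := by fun_prop
          have ht : Filter.Tendsto (fun t : ℝ => y + t • (y' - y)) (nhdsWithin 0 (Set.Ioi 0))
              (nhds y) := by
            simpa using (hc.tendsto 0).mono_left nhdsWithin_le_nhds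
          refine mem_closure_of_tendsto ht ?_
          filter_upwards [self_mem_nhdsWithin] with t ht
          rw [hlin, hy, mul_zero, zero_add]
          exact mul_ne_zero (ne_of_gt ht) hy'
        · exact subset_closure hy
      · simp [h]
  obtain ⟨y, hyU, hy⟩ := hdense.inter_open_nonempty _ c.isOpen_gap_pos ⟨0, by
    simpa [FacetChart.map] using c.gap_base_pos⟩
  refine ⟨y, hyU, fun a ha y' => ?_⟩
  by_contra hne
  exact Set.mem_iInter.1 hy a ⟨y', hne⟩ ha

theorem crossing_mem {a b : ℝ} (ha : 0 < a) (hb : b < 0) :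
    0 < a / (a - b) ∧ a / (a - b) < 1 := by
  have : 0 < a - b := by linarith
  exact ⟨by positivity, (div_lt_one this).2 (by linarith)⟩

theorem crossing_nonneg {a b t : ℝ} (ha : 0 < a) (hb : b < 0) (ht : t ≤ a / (a - b)) :
    0 ≤ (1 - t) * a + t * b := by
  rw [le_div_iff₀ (by linarith)] at ht
  linarith

theorem crossing_eq {a b : ℝ} (ha : 0 < a) (hb : b < 0) :
    (1 - a / (a - b)) * a + a / (a - b) * b = 0 := by
  have : a - b ≠ 0 := by linarith
  field_simp
  ring

/-- Within its hyperplane, a facet is cut out by the half-spaces of the neighboring facets. -/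
theorem mem_face_of_adjacent (hd : 1 ≤ d) {x : EuclideanSpace ℝ (Fin d)} (hx : T.gap i x = 0)
    (h : ∀ j, T.Adjacent i j → 0 ≤ T.gap j x) : x ∈ T.face i := by
  classical
  by_contra hxf
  obtain ⟨c⟩ := T.nonempty_facetChart i hd
  obtain ⟨z, rfl⟩ := c.exists_map_eq hx
  obtain ⟨y, hy, hgen⟩ := c.exists_generic (ι := Fin n × Fin n)
    (fun a y => T.gap a.1 (c.map y) * T.gap a.2 (c.map z) -
      T.gap a.2 (c.map y) * T.gap a.1 (c.map z))
    (fun a => by fun_prop)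
    (fun a y y' t => by rw [c.map_add_smul_sub, gap_add_smul_sub, gap_add_smul_sub]; ring)
  set V : Finset (Fin n) := Finset.univ.filter fun j => T.gap j (c.map z) < 0 with hV
  have hVi : ∀ j ∈ V, j ≠ i := by
    rintro j hj rfl
    have := (Finset.mem_filter.1 hj).2
    rw [c.gap_map] at this
    exact lt_irrefl _ this
  have hVne : V.Nonempty := by
    by_contra hne
    rw [Finset.not_nonempty_iff_eq_empty] at hne
    refine hxf ((T.mem_face_iff i).2 ⟨fun j => ?_, hx⟩)
    by_contra hlt
    have : j ∈ V := by simpa [hV] using hlt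
    simp [hne] at this
  obtain ⟨j₀, hj₀, hmin⟩ := V.exists_min_image
    (fun j => T.gap j (c.map y) / (T.gap j (c.map y) - T.gap j (c.map z))) hVne
  have hzneg : ∀ j ∈ V, T.gap j (c.map z) < 0 := fun j hj => (Finset.mem_filter.1 hj).2
  have hypos : ∀ j ∈ V, 0 < T.gap j (c.map y) := fun j hj => hy j (hVi j hj)
  set t := T.gap j₀ (c.map y) / (T.gap j₀ (c.map y) - T.gap j₀ (c.map z)) with ht
  have ht01 := crossing_mem (hypos j₀ hj₀) (hzneg j₀ hj₀)
  rw [← ht] at ht01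
  set p := c.map (y + t • (z - y)) with hp
  have hgp : ∀ j, T.gap j p = (1 - t) * T.gap j (c.map y) + t * T.gap j (c.map z) := fun j => by
    rw [hp, c.map_add_smul_sub, gap_add_smul_sub]
  have hpj₀ : T.gap j₀ p = 0 := by rw [hgp]; exact crossing_eq (hypos j₀ hj₀) (hzneg j₀ hj₀)
  have hpnn : ∀ j, 0 ≤ T.gap j p := by
    intro j
    by_cases hj : j ∈ V
    · rw [hgp]
      exact crossing_nonneg (hypos j hj) (hzneg j hj) (hmin j hj)
    · have h1 : 0 ≤ T.gap j (c.map z) := by simpa [hV] using hj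
      by_cases hji : j = i
      · rw [hji, hp, c.gap_map]
      · rw [hgp]
        exact add_nonneg (mul_nonneg (by linarith) (hy j hji).le) (mul_nonneg ht01.1.le h1)
  -- every facet that is active at `p` carries the same hyperplane within the chart
  have hact : ∀ j, j ≠ i → T.gap j p = 0 → ∀ y', T.gap j₀ (c.map y') = 0 →
      T.gap j (c.map y') = 0 := by
    intro j hji hj0 y' hy'
    have h1 : T.gap j (c.map y) * T.gap j₀ (c.map z) -
        T.gap j₀ (c.map y) * T.gap j (c.map z) = 0 := by
      rw [hgp] at hj0 hpj₀
      have h2 : (1 - t) ≠ 0 := by linarith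
      apply mul_left_cancel₀ h2
      linear_combination T.gap j₀ (c.map z) * hj0 - T.gap j (c.map z) * hpj₀
    have h3 := hgen (j, j₀) h1 y'
    simp only [hy', zero_mul, sub_zero] at h3
    exact (mul_eq_zero.1 h3).resolve_right (hzneg j₀ hj₀).ne
  have hpmem : p ∈ T.face i ∩ T.face j₀ :=
    ⟨(T.mem_face_iff i).2 ⟨hpnn, c.gap_map _⟩, (T.mem_face_iff j₀).2 ⟨hpnn, hpj₀⟩⟩
  set S : Submodule ℝ (EuclideanSpace ℝ (Fin d)) :=
    Submodule.span ℝ (Set.range ![T.normal i, T.normal j₀]) with hS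
  have hSmem : ∀ v, v ∈ Sᗮ ↔ inner ℝ (T.normal i) v = 0 ∧ inner ℝ (T.normal j₀) v = 0 := by
    intro v
    rw [hS, Submodule.mem_orthogonal]
    constructor
    · intro h
      exact ⟨h _ (Submodule.subset_span ⟨0, rfl⟩), h _ (Submodule.subset_span ⟨1, rfl⟩)⟩
    · rintro ⟨h1, h2⟩ u hu
      induction hu using Submodule.span_induction with
      | mem u hu =>
        obtain ⟨a, rfl⟩ := hu
        fin_cases a
        · exact h1
        · exact h2
      | zero => simp
      | add u u' _ _ hu hu' => rw [inner_add_left, hu, hu', add_zero]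
      | smul a u _ hu => rw [inner_smul_left, hu, mul_zero]
  have hspan : vectorSpan ℝ (T.face i ∩ T.face j₀) = Sᗮ := by
    apply le_antisymm
    · rw [vectorSpan_def, Submodule.span_le]
      rintro _ ⟨a, ha, b, hb, rfl⟩
      refine (hSmem _).2 ⟨?_, ?_⟩
      · have h1 := ((T.mem_face_iff i).1 ha.1).2
        have h2 := ((T.mem_face_iff i).1 hb.1).2
        simp only [gap, vsub_eq_sub, inner_sub_right] at h1 h2 ⊢
        linarith
      · have h1 := ((T.mem_face_iff j₀).1 ha.2).2
        have h2 := ((T.mem_face_iff j₀).1 hb.2).2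
        simp only [gap, vsub_eq_sub, inner_sub_right] at h1 h2 ⊢
        linarith
    · intro v hv
      obtain ⟨hv1, hv2⟩ := (hSmem v).1 hv
      have hev : ∀ᶠ s in nhds (0 : ℝ), ∀ j, 0 < T.gap j p → 0 < T.gap j (p + s • v) := by
        refine Filter.eventually_all.2 fun l => Filter.eventually_imp_distrib_left.2 fun hl => ?_
        have hc : Continuous fun s : ℝ => T.gap l (p + s • v) := by fun_prop
        exact hc.continuousAt.eventually (lt_mem_nhds (by simpa using hl))
      obtain ⟨s, hs, hs0⟩ := ((hev.filter_mono nhdsWithin_le_nhds).and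
        (self_mem_nhdsWithin : Set.Ioi (0 : ℝ) ∈ nhdsWithin 0 (Set.Ioi 0))).exists
      have hi : T.gap i (p + s • v) = 0 := by
        rw [gap_add, inner_smul_right, hv1, hp, c.gap_map]; ring
      have hj : T.gap j₀ (p + s • v) = 0 := by
        rw [gap_add, inner_smul_right, hv2, hpj₀]; ring
      obtain ⟨y', hy'⟩ := c.exists_map_eq hi
      have hnn : ∀ j, 0 ≤ T.gap j (p + s • v) := by
        intro j
        by_cases hji : j = i
        · rw [hji, hi]
        rcases (hpnn j).lt_or_eq with hlt | heq
        · exact (hs j hlt).le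
        · rw [← hy', hact j hji heq.symm y' (by rw [hy', hj])]
      have hmem : p + s • v ∈ T.face i ∩ T.face j₀ :=
        ⟨(T.mem_face_iff i).2 ⟨hnn, hi⟩, (T.mem_face_iff j₀).2 ⟨hnn, hj⟩⟩
      have := vsub_mem_vectorSpan ℝ hmem hpmem
      rw [vsub_eq_sub, add_sub_cancel_left] at this
      exact (Submodule.smul_mem_iff _ (ne_of_gt hs0)).1 this
  have hindep : LinearIndependent ℝ ![T.normal i, T.normal j₀] := by
    rw [LinearIndependent.pair_iff]
    intro a b hab
    have h1 : inner ℝ (T.normal i) (c.map y - c.map z) = 0 := by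
      have e1 := c.gap_map y
      have e2 := c.gap_map z
      simp only [gap, inner_sub_right] at e1 e2 ⊢
      linarith
    have h2 : inner ℝ (T.normal j₀) (c.map y - c.map z) < 0 := by
      have e1 := hypos j₀ hj₀
      have e2 := hzneg j₀ hj₀
      simp only [gap, inner_sub_right] at e1 e2 ⊢
      linarith
    have h3 : inner ℝ (a • T.normal i + b • T.normal j₀) (c.map y - c.map z) = 0 := by
      rw [hab, inner_zero_left]
    rw [inner_add_left, inner_smul_left, inner_smul_left, h1, mul_zero, zero_add] at h3
    have hb : b = 0 := (mul_eq_zero.1 h3).resolve_right h2.ne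
    refine ⟨?_, hb⟩
    rw [hb, zero_smul, add_zero] at hab
    refine (smul_eq_zero.1 hab).resolve_right fun h0 => ?_
    have := T.norm_normal i
    simp [h0] at this
  have hfin : Module.finrank ℝ Sᗮ = d - 2 := by
    have h1 := S.finrank_add_finrank_orthogonal
    rw [hS, finrank_span_eq_card hindep, ← hS, finrank_euclideanSpace_fin, Fintype.card_fin] at h1
    omega
  have hadj : T.Adjacent i j₀ := ⟨(hVi j₀ hj₀).symm, ⟨p, hpmem⟩, by rw [hspan, hfin]⟩
  exact absurd (h j₀ hadj) (not_le.2 (hzneg j₀ hj₀))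

/-- A ray from the barycenter of a facet leaves the facet through a neighboring facet. -/
theorem exists_adjacent_exit (hd : 1 ≤ d) {y : EuclideanSpace ℝ (Fin d)} (hy : T.gap i y = 0)
    (hyf : y ∉ T.face i) :
    ∃ j, T.Adjacent i j ∧ ∃ s : ℝ, 0 < s ∧ s < 1 ∧
      T.faceBarycenter i + s • (y - T.faceBarycenter i) ∈ T.face i ∧
      T.gap j (T.faceBarycenter i + s • (y - T.faceBarycenter i)) = 0 := by
  classical
  set m := T.faceBarycenter i
  set V : Finset (Fin n) := Finset.univ.filter fun j => T.Adjacent i j ∧ T.gap j y < 0 with hV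
  have hVne : V.Nonempty := by
    by_contra hne
    rw [Finset.not_nonempty_iff_eq_empty] at hne
    refine hyf (T.mem_face_of_adjacent i hd hy fun j hj => ?_)
    by_contra hlt
    have : j ∈ V := by simpa [hV] using ⟨hj, not_le.1 hlt⟩
    simp [hne] at this
  obtain ⟨j₀, hj₀, hmin⟩ := V.exists_min_image
    (fun j => T.gap j m / (T.gap j m - T.gap j y)) hVne
  have hneg : ∀ j ∈ V, T.gap j y < 0 := fun j hj => (Finset.mem_filter.1 hj).2.2
  have hadj : ∀ j ∈ V, T.Adjacent i j := fun j hj => (Finset.mem_filter.1 hj).2.1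
  have hpos : ∀ j, T.Adjacent i j → 0 < T.gap j m := fun j hj =>
    T.gap_faceBarycenter_pos hd hj.1.symm
  have h01 := crossing_mem (hpos j₀ (hadj j₀ hj₀)) (hneg j₀ hj₀)
  refine ⟨j₀, hadj j₀ hj₀, _, h01.1, h01.2, T.mem_face_of_adjacent i hd ?_ fun j hj => ?_, ?_⟩
  · rw [gap_add_smul_sub, hy, T.gap_faceBarycenter_self i hd]; ring
  · rw [gap_add_smul_sub]
    by_cases hjV : j ∈ V
    · exact crossing_nonneg (hpos j hj) (hneg j hjV) (hmin j hjV)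
    · have h1 : 0 ≤ T.gap j y := by
        by_contra hlt
        exact hjV (by simpa [hV] using ⟨hj, not_le.1 hlt⟩)
      exact add_nonneg (mul_nonneg (by linarith) (hpos j hj).le) (mul_nonneg h01.1.le h1)
  · rw [gap_add_smul_sub]
    exact crossing_eq (hpos j₀ (hadj j₀ hj₀)) (hneg j₀ hj₀)

end ConvexPolytope

namespace ConvexPolytope

variable {d n : ℕ} (T : ConvexPolytope d n) (i : Fin n)

theorem inner_normal_self : inner ℝ (T.normal i) (T.normal i) = 1 := by
  rw [real_inner_self_eq_norm_sq, T.norm_normal]; norm_num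

theorem gap_add_smul_normal (j : Fin n) (x : EuclideanSpace ℝ (Fin d)) (t : ℝ) :
    T.gap j (x + t • T.normal i) = T.gap j x - t * inner ℝ (T.normal j) (T.normal i) := by
  rw [gap_add, inner_smul_right]

theorem gap_sub_smul_normal (j : Fin n) (x : EuclideanSpace ℝ (Fin d)) (t : ℝ) :
    T.gap j (x - t • T.normal i) = T.gap j x + t * inner ℝ (T.normal j) (T.normal i) := by
  rw [sub_eq_add_neg, ← neg_smul, gap_add_smul_normal]; ring

/-- The height of `T` above the barycenter of a facet. -/
theorem exists_height (hd : 1 ≤ d) :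
    ∃ σ : ℝ, 0 < σ ∧ T.faceBarycenter i - σ • T.normal i ∈ T.carrier ∧
      ∀ ζ : ℝ, T.faceBarycenter i - ζ • T.normal i ∈ T.carrier → ζ ≤ σ := by
  set m := T.faceBarycenter i
  have hiso : Isometry fun ζ : ℝ => m - ζ • T.normal i := Isometry.of_dist_eq fun a b => by
    rw [dist_sub_left, dist_eq_norm, ← sub_smul, norm_smul, T.norm_normal, mul_one]
    rfl
  have hcomp := hiso.isClosedEmbedding.isCompact_preimage T.isCompact_carrier
  have hev : ∀ᶠ t in nhds (0 : ℝ), ∀ l, l ≠ i → 0 < T.gap l (m - t • T.normal i) := by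
    refine Filter.eventually_all.2 fun l => Filter.eventually_imp_distrib_left.2 fun hl => ?_
    have hc : Continuous fun t : ℝ => T.gap l (m - t • T.normal i) := by fun_prop
    exact hc.continuousAt.eventually
      (lt_mem_nhds (by simpa using T.gap_faceBarycenter_pos hd hl))
  obtain ⟨t, ht, ht0⟩ := ((hev.filter_mono nhdsWithin_le_nhds).and
    (self_mem_nhdsWithin : Set.Ioi (0 : ℝ) ∈ nhdsWithin 0 (Set.Ioi 0))).exists
  have ht0 : 0 < t := ht0
  have hmem : m - t • T.normal i ∈ T.carrier := T.mem_carrier_iff.2 fun l => by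
    by_cases h : l = i
    · rw [h, gap_sub_smul_normal, T.gap_faceBarycenter_self i hd, inner_normal_self]
      linarith
    · exact (ht l h).le
  obtain ⟨σ, hσ, hmax⟩ := hcomp.exists_isGreatest ⟨t, hmem⟩
  exact ⟨σ, ht0.trans_le (hmax hmem), hσ, fun ζ hζ => hmax hζ⟩

theorem height_le_diam (hd : 1 ≤ d) {σ : ℝ}
    (h : T.faceBarycenter i - σ • T.normal i ∈ T.carrier) : σ ≤ Metric.diam T.carrier := by
  have := Metric.dist_le_diam_of_mem T.bounded
    (T.face_subset_carrier i (T.faceBarycenter_mem_face i hd)) h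
  rw [dist_self_sub_right, norm_smul, T.norm_normal, mul_one] at this
  exact (le_abs_self σ).trans this

theorem diam_pos (i : Fin n) (hd : 1 ≤ d) : 0 < Metric.diam T.carrier := by
  obtain ⟨σ, h0, h1, -⟩ := T.exists_height i hd
  exact h0.trans_le (T.height_le_diam i hd h1)

/-- The projection to the hyperplane of a facet does not increase distances to its barycenter. -/
theorem dist_proj_faceBarycenter_le (hd : 1 ≤ d) {x : EuclideanSpace ℝ (Fin d)}
    (hx : x ∈ T.carrier) :
    dist (x + T.gap i x • T.normal i) (T.faceBarycenter i) ≤ Metric.diam T.carrier := by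
  refine le_trans ?_ (Metric.dist_le_diam_of_mem T.bounded hx
    (T.face_subset_carrier i (T.faceBarycenter_mem_face i hd)))
  have h0 := T.gap_faceBarycenter_self i hd
  set m := T.faceBarycenter i
  set v := x - m with hv
  have hg : T.gap i x = -inner ℝ (T.normal i) v := by
    simp only [gap, hv, inner_sub_right] at h0 ⊢; linarith
  rw [dist_eq_norm, dist_eq_norm, hg,
    show x + -inner ℝ (T.normal i) v • T.normal i - m = v - inner ℝ (T.normal i) v • T.normal i by
      rw [hv, neg_smul]; abel]
  refine (sq_le_sq₀ (norm_nonneg _) (norm_nonneg _)).1 ?_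
  rw [norm_sub_sq_real, norm_smul, T.norm_normal, inner_smul_right, real_inner_comm (T.normal i) v,
    Real.norm_eq_abs, mul_one, sq_abs]
  nlinarith [sq_nonneg (inner ℝ (T.normal i) v)]

theorem gap_proj (x : EuclideanSpace ℝ (Fin d)) : T.gap i (x + T.gap i x • T.normal i) = 0 := by
  rw [gap_add_smul_normal, inner_normal_self]; ring

namespace IsRegularAt

variable {T i} {α₀ ρ κ : ℝ}

/-- A disc about the barycenter lies in the facet. -/
theorem mem_face_of_dist_le (h : T.IsRegularAt i α₀ ρ κ) (hd : 1 ≤ d) (hρ : 0 < ρ) (hκ : 0 < κ)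
    {y : EuclideanSpace ℝ (Fin d)} (hy : T.gap i y = 0)
    (hym : dist y (T.faceBarycenter i) ≤ κ * ρ / 2 * Metric.diam T.carrier) : y ∈ T.face i := by
  by_contra hyf
  obtain ⟨j, hadj, s, hs0, hs1, hp, hpj⟩ := T.exists_adjacent_exit i hd hy hyf
  set m := T.faceBarycenter i
  have h1 := h.barycenter j hadj
  have h2 := h.ratio i
  have h3 := T.diam_pos i hd
  have hpm : m + s • (y - m) ∈ T.face i ∩ T.face j :=
    ⟨hp, (T.mem_face_iff j).2 ⟨((T.mem_face_iff i).1 hp).1, hpj⟩⟩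
  have h4 := Metric.infDist_le_dist_of_mem (x := m) hpm
  rw [dist_self_add_right, norm_smul, ← dist_eq_norm, Real.norm_of_nonneg hs0.le] at h4
  have h5 : s * dist y m ≤ dist y m := mul_le_of_le_one_left dist_nonneg hs1.le
  have h6 : κ * (ρ * Metric.diam T.carrier) ≤ κ * Metric.diam (T.face i) := by gcongr
  have h7 : 0 < κ * (ρ * Metric.diam T.carrier) := by positivity
  linarith

/-- The part of a normal that is parallel to the facet bounds the distance of its barycenter to
the other hyperplanes from below. -/
theorem mul_sqrt_le_gap (h : T.IsRegularAt i α₀ ρ κ) (hd : 1 ≤ d) (hρ : 0 < ρ) (hκ : 0 < κ)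
    (j : Fin n) :
    κ * ρ / 2 * Metric.diam T.carrier *
      √(1 - inner ℝ (T.normal j) (T.normal i) ^ 2) ≤ T.gap j (T.faceBarycenter i) := by
  set m := T.faceBarycenter i with hm
  set R := κ * ρ / 2 * Metric.diam T.carrier with hR
  set a := inner ℝ (T.normal j) (T.normal i) with ha
  set τ := T.normal j - a • T.normal i with hτ
  have hm0 : 0 ≤ T.gap j m := ((T.mem_face_iff i).1 (T.faceBarycenter_mem_face i hd)).1 j
  have hi : inner ℝ (T.normal i) τ = 0 := by
    rw [hτ, inner_sub_right, inner_smul_right, inner_normal_self, ha, real_inner_comm]; ring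
  have hj : inner ℝ (T.normal j) τ = 1 - a ^ 2 := by
    rw [hτ, inner_sub_right, inner_smul_right, inner_normal_self, ← ha]; ring
  have hτn : ‖τ‖ ^ 2 = 1 - a ^ 2 := by
    rw [← real_inner_self_eq_norm_sq, ← hj]
    nth_rw 1 [hτ]
    rw [inner_sub_left, inner_smul_left, hi]; simp
  rw [← hτn, Real.sqrt_sq (norm_nonneg _)]
  rcases eq_or_ne τ 0 with h0 | h0
  · simpa [h0] using hm0
  have hpos : 0 < ‖τ‖ := norm_pos_iff.2 h0
  have hRpos : 0 < R := by have := T.diam_pos i hd; positivity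
  have hy : m + (R / ‖τ‖) • τ ∈ T.face i := by
    refine h.mem_face_of_dist_le hd hρ hκ ?_ ?_
    · rw [gap_add, inner_smul_right, hi, T.gap_faceBarycenter_self i hd]; ring
    · rw [← hm, dist_self_add_left, norm_smul, Real.norm_of_nonneg (by positivity),
        div_mul_cancel₀ _ hpos.ne']
  have := ((T.mem_face_iff i).1 hy).1 j
  rw [gap_add, inner_smul_right, hj, ← hτn] at this
  have e : R / ‖τ‖ * ‖τ‖ ^ 2 = R * ‖τ‖ := by field_simp
  linarith

theorem sin_le_sqrt (h : T.IsRegularAt i α₀ ρ κ) (hα₀ : 0 < α₀) {j : Fin n} (hadj : T.Adjacent i j) :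
    Real.sin (min α₀ (Real.pi / 2)) ≤ √(1 - inner ℝ (T.normal j) (T.normal i) ^ 2) := by
  set φ := InnerProductGeometry.angle (T.normal i) (T.normal j) with hφ
  have h1 := h.angle_ge j hadj
  have h2 := h.angle_le j hadj
  have h3 := Real.pi_pos
  have hφ0 : 0 ≤ φ := InnerProductGeometry.angle_nonneg _ _
  have hφπ : φ ≤ Real.pi := InnerProductGeometry.angle_le_pi _ _
  have hcos : inner ℝ (T.normal j) (T.normal i) = Real.cos φ := by
    rw [hφ, InnerProductGeometry.cos_angle, T.norm_normal, T.norm_normal, real_inner_comm]; simp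
  rw [hcos, ← Real.sin_eq_sqrt_one_sub_cos_sq hφ0 hφπ]
  have hα : α₀ ≤ Real.pi / 2 := by linarith
  rw [min_eq_left hα]
  rcases le_total φ (Real.pi / 2) with hle | hle
  · exact Real.sin_le_sin_of_le_of_le_pi_div_two (by linarith) hle h1
  · rw [← Real.sin_pi_sub φ]
    exact Real.sin_le_sin_of_le_of_le_pi_div_two (by linarith) (by linarith) (by linarith)

theorem mul_inner_le_gap (h : T.IsRegularAt i α₀ ρ κ) (hd : 1 ≤ d) (hα₀ : 0 < α₀) (hρ : 0 < ρ) (hκ : 0 < κ)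
    {j : Fin n} (hji : j ≠ i) (ha : 0 < inner ℝ (T.normal j) (T.normal i)) :
    inner ℝ (T.normal j) (T.normal i) * (κ * ρ / 2 * Metric.diam T.carrier *
      Real.sin (min α₀ (Real.pi / 2))) ≤ T.gap j (T.faceBarycenter i) := by
  set m := T.faceBarycenter i with hm
  set B := κ * ρ / 2 * Metric.diam T.carrier * Real.sin (min α₀ (Real.pi / 2)) with hB
  obtain ⟨x, hxj, hx⟩ := T.exists_gap_eq_zero j
  have hζ := hx i hji.symm
  set ζ := T.gap i x
  set y := x + ζ • T.normal i with hy
  have hyi : T.gap i y = 0 := T.gap_proj i x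
  have hyj : T.gap j y = -(ζ * inner ℝ (T.normal j) (T.normal i)) := by
    rw [hy, gap_add_smul_normal, hxj]; ring
  have hyf : y ∉ T.face i := fun hmem => by
    have := ((T.mem_face_iff i).1 hmem).1 j
    have := mul_pos hζ ha
    linarith
  obtain ⟨l, hadj, s, hs0, hs1, hp, hpl⟩ := T.exists_adjacent_exit i hd hyi hyf
  rw [← hm] at hp hpl
  have hxl : 0 ≤ T.gap l x := by
    by_cases hlj : l = j
    · rw [hlj, hxj]
    · exact (hx l hlj).le
  have hal : inner ℝ (T.normal l) (T.normal i) ≤ 1 := by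
    have := real_inner_le_norm (T.normal l) (T.normal i)
    simpa [T.norm_normal] using this
  have hyl : -ζ ≤ T.gap l y := by
    rw [hy, gap_add_smul_normal]
    nlinarith
  have hml : B ≤ T.gap l m := by
    refine le_trans ?_ (h.mul_sqrt_le_gap hd hρ hκ l)
    rw [hB]
    have := T.diam_pos i hd
    exact mul_le_mul_of_nonneg_left (h.sin_le_sqrt hα₀ hadj) (by positivity)
  have hpj := ((T.mem_face_iff i).1 hp).1 j
  rw [gap_add_smul_sub] at hpl hpj
  rw [hyj] at hpj
  have hs1' : 0 < 1 - s := by linarith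
  have h1 : (1 - s) * B ≤ s * ζ := by nlinarith
  have h2 : (1 - s) * (inner ℝ (T.normal j) (T.normal i) * B) ≤ (1 - s) * T.gap j m := by
    nlinarith
  exact le_of_mul_le_mul_left h2 hs1'

theorem abs_inner_mul_height_le (h : T.IsRegularAt i α₀ ρ κ) (hd : 1 ≤ d) (hα₀ : 0 < α₀)
    (hρ : 0 < ρ) (hκ : 0 < κ) {σ : ℝ}
    (hσm : T.faceBarycenter i - σ • T.normal i ∈ T.carrier) {j : Fin n} (hji : j ≠ i) :
    |inner ℝ (T.normal j) (T.normal i)| * σ ≤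
      (1 + 1 / (κ * ρ / 2 * Real.sin (min α₀ (Real.pi / 2)))) *
        T.gap j (T.faceBarycenter i) := by
  have hS : 0 < Real.sin (min α₀ (Real.pi / 2)) := by
    have := Real.pi_pos
    exact Real.sin_pos_of_pos_of_lt_pi (by positivity)
      ((min_le_right _ _).trans_lt (by linarith))
  have hm0 := T.gap_faceBarycenter_pos hd hji
  set D := κ * ρ / 2 * Real.sin (min α₀ (Real.pi / 2)) with hD
  have hD0 : 0 < D := by positivity
  rcases le_or_gt (inner ℝ (T.normal j) (T.normal i)) 0 with ha | ha
  · have h1 := T.mem_carrier_iff.1 hσm j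
    rw [gap_sub_smul_normal] at h1
    rw [abs_of_nonpos ha]
    have : 0 < 1 / D * T.gap j (T.faceBarycenter i) := by positivity
    linarith
  · have h1 := h.mul_inner_le_gap hd hα₀ hρ hκ hji ha
    have h2 := T.height_le_diam i hd hσm
    rw [abs_of_pos ha]
    have h3 : inner ℝ (T.normal j) (T.normal i) * σ ≤ 1 / D * T.gap j (T.faceBarycenter i) := by
      rw [one_div_mul_eq_div, le_div_iff₀ hD0]
      calc inner ℝ (T.normal j) (T.normal i) * σ * D
          ≤ inner ℝ (T.normal j) (T.normal i) * Metric.diam T.carrier * D := by gcongr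
        _ ≤ _ := by rw [hD]; linarith
    linarith

/-- Reflecting the projection of `x` in the barycenter, and scaling it into the facet, gives a
point of `T` below the barycenter on the segment from `x`. -/
theorem exists_reflection (h : T.IsRegularAt i α₀ ρ κ) (hd : 1 ≤ d) (hρ : 0 < ρ) (hκ : 0 < κ)
    {x : EuclideanSpace ℝ (Fin d)} (hx : x ∈ T.carrier) :
    ∃ y ∈ T.face i, x + (1 / (1 + κ * ρ / 2)) • (y - x) =
      T.faceBarycenter i - (κ * ρ / 2 / (1 + κ * ρ / 2) * T.gap i x) • T.normal i := by
  set m := T.faceBarycenter i with hm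
  set c := κ * ρ / 2 with hc
  have hc0 : 0 < c := by positivity
  set z := x + T.gap i x • T.normal i with hz
  refine ⟨m + (-c) • (z - m), h.mem_face_of_dist_le hd hρ hκ ?_ ?_, ?_⟩
  · rw [gap_add_smul_sub, T.gap_proj i x, T.gap_faceBarycenter_self i hd]; ring
  · rw [← hm, dist_self_add_left, norm_smul, ← dist_eq_norm, norm_neg,
      Real.norm_of_nonneg hc0.le]
    gcongr
    exact T.dist_proj_faceBarycenter_le i hd hx
  · rw [hz]
    have h1 : 1 + c ≠ 0 := by positivity
    match_scalars <;> field_simp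
    all_goals ring

theorem mul_gap_le_height (h : T.IsRegularAt i α₀ ρ κ) (hd : 1 ≤ d) (hρ : 0 < ρ) (hκ : 0 < κ)
    {σ : ℝ} (hmax : ∀ ζ : ℝ, T.faceBarycenter i - ζ • T.normal i ∈ T.carrier → ζ ≤ σ)
    {x : EuclideanSpace ℝ (Fin d)} (hx : x ∈ T.carrier) :
    κ * ρ / 2 / (1 + κ * ρ / 2) * T.gap i x ≤ σ := by
  obtain ⟨y, hy, hxy⟩ := h.exists_reflection hd hρ hκ hx
  refine hmax _ (hxy ▸ T.convex_carrier.add_smul_sub_mem hx hy.1 ⟨by positivity, ?_⟩)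
  rw [div_le_one (by positivity)]
  have : 0 < κ * ρ / 2 := by positivity
  linarith

theorem mul_gap_le (h : T.IsRegularAt i α₀ ρ κ) (hd : 1 ≤ d) (hα₀ : 0 < α₀) (hρ : 0 < ρ)
    (hκ : 0 < κ) {σ : ℝ}
    (hσm : T.faceBarycenter i - σ • T.normal i ∈ T.carrier)
    (hmax : ∀ ζ : ℝ, T.faceBarycenter i - ζ • T.normal i ∈ T.carrier → ζ ≤ σ)
    {j : Fin n} (hji : j ≠ i) {x : EuclideanSpace ℝ (Fin d)} (hx : x ∈ T.carrier) :
    κ * ρ / 2 / (1 + κ * ρ / 2) * T.gap j x ≤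
      (2 + 1 / (κ * ρ / 2 * Real.sin (min α₀ (Real.pi / 2)))) *
        T.gap j (T.faceBarycenter i) := by
  obtain ⟨y, hy, hxy⟩ := h.exists_reflection hd hρ hκ hx
  have h1 := congrArg (T.gap j) hxy
  have h2 := h.mul_gap_le_height hd hρ hκ hmax hx
  have h3 := h.abs_inner_mul_height_le hd hα₀ hρ hκ hσm hji
  have h4 := ((T.mem_face_iff i).1 hy).1 j
  have h5 := T.mem_carrier_iff.1 hx i
  rw [gap_add_smul_sub, gap_sub_smul_normal] at h1
  set c := κ * ρ / 2
  have hc0 : 0 < c := by positivity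
  have e : 1 - 1 / (1 + c) = c / (1 + c) := by field_simp; ring
  rw [e] at h1
  have h6 : c / (1 + c) * T.gap i x * inner ℝ (T.normal j) (T.normal i) ≤
      |inner ℝ (T.normal j) (T.normal i)| * σ := by
    rw [mul_comm]
    exact (mul_le_mul_of_nonneg_right (le_abs_self _) (by positivity)).trans
      (mul_le_mul_of_nonneg_left h2 (abs_nonneg _))
  have h7 : 0 ≤ 1 / (1 + c) * T.gap j y := by positivity
  linarith

end IsRegularAt

/-- `T` lies in a box with one side given by its extent in the direction of a normal. -/
theorem volume_carrier_le (hd : 1 ≤ d) {L : ℝ} (hL : ∀ x ∈ T.carrier, T.gap i x ≤ L) :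
    volume.real T.carrier ≤ L * (2 * Metric.diam T.carrier) ^ (d - 1) := by
  set h := Metric.diam T.carrier with hh
  have h0 : 0 ≤ h := Metric.diam_nonneg
  set m := T.faceBarycenter i with hm
  have hmT := T.face_subset_carrier i (T.faceBarycenter_mem_face i hd)
  have hL0 : 0 ≤ L := (T.mem_carrier_iff.1 hmT i).trans (hL m hmT)
  let l₀ : Fin d := ⟨0, hd⟩
  have hv : Orthonormal ℝ (({l₀} : Set (Fin d)).domRestrict fun _ => T.normal i) := by
    refine ⟨fun _ => T.norm_normal i, fun a b hab => ?_⟩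
    exact absurd (Subtype.ext (a.2.trans b.2.symm)) hab
  obtain ⟨b, hb⟩ := hv.exists_orthonormalBasis_extension_of_card_eq (by simp)
  have hb0 : b l₀ = T.normal i := hb l₀ rfl
  let lo : Fin d → ℝ := fun l => if l = l₀ then T.offset i - L else inner ℝ (b l) m - h
  let hi : Fin d → ℝ := fun l => if l = l₀ then T.offset i else inner ℝ (b l) m + h
  have hsub : T.carrier ⊆ b.repr ⁻¹' (WithLp.ofLp ⁻¹' Set.Icc lo hi) := by
    intro x hx
    have key : ∀ l, lo l ≤ b.repr x l ∧ b.repr x l ≤ hi l := by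
      intro l
      rw [b.repr_apply_apply]
      by_cases hl : l = l₀
      · have h1 := hL x hx
        have h2 := T.mem_carrier_iff.1 hx i
        simp only [lo, hi, hl, if_true, hb0]
        rw [gap] at h1 h2
        constructor <;> linarith
      · simp only [lo, hi, hl, if_false]
        have h1 := abs_real_inner_le_norm (b l) (x - m)
        rw [b.orthonormal.1 l, one_mul, ← dist_eq_norm, inner_sub_right] at h1
        have h2 : dist x m ≤ h := Metric.dist_le_diam_of_mem T.bounded hx hmT
        have h3 := abs_le.1 (h1.trans h2)
        constructor <;> linarith [h3.1, h3.2]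
    exact ⟨fun l => (key l).1, fun l => (key l).2⟩
  have hvol : volume (b.repr ⁻¹' (WithLp.ofLp ⁻¹' Set.Icc lo hi)) =
      ENNReal.ofReal (L * (2 * h) ^ (d - 1)) := by
    rw [b.measurePreserving_repr.measure_preimage
        ((PiLp.volume_preserving_ofLp _).measurable measurableSet_Icc).nullMeasurableSet,
      (PiLp.volume_preserving_ofLp _).measure_preimage measurableSet_Icc.nullMeasurableSet,
      Real.volume_Icc_pi, ← Finset.mul_prod_erase _ _ (Finset.mem_univ l₀),
      Finset.prod_congr rfl (g := fun _ => ENNReal.ofReal (2 * h)), Finset.prod_const,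
      Finset.card_erase_of_mem (Finset.mem_univ _), Finset.card_univ, Fintype.card_fin,
      ENNReal.ofReal_mul hL0, ENNReal.ofReal_pow (by positivity)]
    · simp [lo, hi]
    · intro l hl
      have := Finset.ne_of_mem_erase hl
      simp only [lo, hi, this, if_false]
      congr 1
      ring
  refine ENNReal.toReal_le_of_le_ofReal (by positivity) ?_
  exact hvol ▸ measure_mono hsub

theorem FacetChart.mul_pow_le_volume_dom {T : ConvexPolytope d n} {i : Fin n}
    (c : FacetChart T i) (hd : 1 ≤ d) {R : ℝ} (hR : 0 ≤ R)
    (h : ∀ y, T.gap i y = 0 → dist y (T.faceBarycenter i) ≤ R → y ∈ T.face i) :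
    R ^ (d - 1) * volume.real (Metric.ball (0 : EuclideanSpace ℝ (Fin (d - 1))) 1) ≤
      volume.real c.dom := by
  obtain ⟨z, hz⟩ := c.exists_map_eq (T.gap_faceBarycenter_self i hd)
  have hsub : Metric.closedBall z R ⊆ c.dom := fun y hy => by
    refine h _ (c.gap_map y) ?_
    rw [← hz, c.isometry_map.dist_eq]
    exact hy
  refine le_trans (le_of_eq ?_) (measureReal_mono hsub c.isCompact_dom.measure_lt_top.ne)
  rw [measureReal_def, measureReal_def, Measure.addHaar_closedBall _ _ hR, ENNReal.toReal_mul,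
    ENNReal.toReal_ofReal (by positivity), finrank_euclideanSpace_fin]

/-- The geometric consequences of shape regularity. -/
theorem exists_regularity_constants (hd : 1 ≤ d) {α₀ ρ κ : ℝ} (hα₀ : 0 < α₀) (hρ : 0 < ρ)
    (hκ : 0 < κ) :
    ∃ c A Λ Cv : ℝ, 0 < c ∧ 0 < A ∧ 0 < Λ ∧ 0 < Cv ∧
      ∀ {n : ℕ} (T : ConvexPolytope d n) (i : Fin n), T.IsRegularAt i α₀ ρ κ →
      ∃ σ : ℝ, 0 < σ ∧ σ ≤ Metric.diam T.carrier ∧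
        T.faceBarycenter i - σ • T.normal i ∈ T.carrier ∧
        (∀ y, T.gap i y = 0 → dist y (T.faceBarycenter i) ≤ c * Metric.diam T.carrier →
          y ∈ T.face i) ∧
        (∀ x ∈ T.carrier, T.gap i x ≤ Λ * σ) ∧
        (∀ j, j ≠ i → ∀ x ∈ T.carrier, T.gap j x ≤ Λ * T.gap j (T.faceBarycenter i)) ∧
        (∀ j, j ≠ i → |inner ℝ (T.normal j) (T.normal i)| * σ ≤
          A * T.gap j (T.faceBarycenter i)) ∧
        ∀ ch : FacetChart T i, volume.real T.carrier ≤ Cv * σ * volume.real ch.dom := by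
  set c := κ * ρ / 2 with hc
  have hc0 : 0 < c := by positivity
  set S := Real.sin (min α₀ (Real.pi / 2)) with hS
  have hS0 : 0 < S := by
    have := Real.pi_pos
    exact Real.sin_pos_of_pos_of_lt_pi (by positivity)
      ((min_le_right _ _).trans_lt (by linarith))
  set θ := c / (1 + c) with hθ
  have hθ0 : 0 < θ := by positivity
  set β := volume.real (Metric.ball (0 : EuclideanSpace ℝ (Fin (d - 1))) 1) with hβ
  have hβ0 : 0 < β := ENNReal.toReal_pos
    (Metric.measure_ball_pos _ _ one_pos).ne' measure_ball_lt_top.ne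
  set Λ := (2 + 1 / (c * S)) / θ with hΛ
  have hΛ0 : 0 < Λ := by positivity
  refine ⟨c, 1 + 1 / (c * S), Λ, Λ * 2 ^ (d - 1) / (c ^ (d - 1) * β), hc0, by positivity, hΛ0,
    by positivity, fun T i h => ?_⟩
  obtain ⟨σ, hσ, hσm, hmax⟩ := T.exists_height i hd
  have hdepth : ∀ x ∈ T.carrier, T.gap i x ≤ Λ * σ := fun x hx => by
    have h1 := h.mul_gap_le_height hd hρ hκ hmax hx
    have h2 : 0 < 1 / (c * S) * σ := by positivity
    rw [hΛ, div_mul_eq_mul_div, le_div_iff₀ hθ0, mul_comm]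
    linarith
  refine ⟨σ, hσ, T.height_le_diam i hd hσm, hσm,
    fun y hy hym => h.mem_face_of_dist_le hd hρ hκ hy hym, hdepth, fun j hj x hx => ?_,
    fun j hj => h.abs_inner_mul_height_le hd hα₀ hρ hκ hσm hj, fun ch => ?_⟩
  · have h1 := h.mul_gap_le hd hα₀ hρ hκ hσm hmax hj hx
    rw [hΛ, div_mul_eq_mul_div, le_div_iff₀ hθ0, mul_comm]
    exact h1
  · have h1 := T.volume_carrier_le i hd hdepth
    have hD := T.diam_pos i hd
    have h2 := ch.mul_pow_le_volume_dom hd (R := c * Metric.diam T.carrier) (by positivity)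
      fun y hy hym => h.mem_face_of_dist_le hd hρ hκ hy hym
    calc volume.real T.carrier ≤ Λ * σ * (2 * Metric.diam T.carrier) ^ (d - 1) := h1
      _ = Λ * 2 ^ (d - 1) / (c ^ (d - 1) * β) * σ *
          ((c * Metric.diam T.carrier) ^ (d - 1) * β) := by
          rw [mul_pow, mul_pow]; field_simp
      _ ≤ _ := by gcongr

end ConvexPolytope

section Galerkin

variable {d : ℕ}

/-- A finite-dimensional linear problem with a symmetric form is solvable when the right-hand side
vanishes on the isotropic vectors. -/
theorem exists_form_eq {V : Type*} [AddCommGroup V] [Module ℝ V] [FiniteDimensional ℝ V]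
    (B : V →ₗ[ℝ] V →ₗ[ℝ] ℝ) (hB : ∀ x y, B x y = B y x) (F : V →ₗ[ℝ] ℝ)
    (hF : ∀ x, B x x = 0 → F x = 0) : ∃ r, ∀ p, B r p = F p := by
  have h : F ∈ LinearMap.range (Module.Dual.transpose (R := ℝ) B) := by
    change F ∈ LinearMap.range B.dualMap
    rw [LinearMap.range_dualMap_eq_dualAnnihilator_ker, Submodule.mem_dualAnnihilator]
    intro x hx
    exact hF x (by rw [LinearMap.mem_ker.1 hx]; rfl)
  obtain ⟨Φ, hΦ⟩ := h
  obtain ⟨r, rfl⟩ := (Module.evalEquiv ℝ V).surjective Φ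
  refine ⟨r, fun p => ?_⟩
  rw [hB, ← hΦ]
  rfl

theorem exists_galerkin (V : Submodule ℝ (MvPolynomial (Fin d) ℝ)) [FiniteDimensional ℝ V]
    {μ : Measure (EuclideanSpace ℝ (Fin d))}
    (hμ : ∀ f : EuclideanSpace ℝ (Fin d) → ℝ, Continuous f → Integrable f μ)
    {w g : EuclideanSpace ℝ (Fin d) → ℝ} (hw : Continuous w) (hg : Continuous g)
    (h : ∀ p ∈ V, ∫ x, w x * polyVal p x * polyVal p x ∂μ = 0 →
      ∫ x, g x * polyVal p x ∂μ = 0) :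
    ∃ r ∈ V, ∀ p ∈ V, ∫ x, w x * polyVal r x * polyVal p x ∂μ = ∫ x, g x * polyVal p x ∂μ := by
  let B : V →ₗ[ℝ] V →ₗ[ℝ] ℝ := LinearMap.mk₂ ℝ
    (fun r p => ∫ x, w x * polyVal r.1 x * polyVal p.1 x ∂μ)
    (fun r r' p => by
      rw [← integral_add (hμ _ (by fun_prop)) (hμ _ (by fun_prop))]
      congr 1 with x
      simp; ring)
    (fun a r p => by
      rw [smul_eq_mul, ← integral_const_mul]
      congr 1 with x
      simp; ring)
    (fun r p p' => by
      rw [← integral_add (hμ _ (by fun_prop)) (hμ _ (by fun_prop))]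
      congr 1 with x
      simp; ring)
    (fun a r p => by
      rw [smul_eq_mul, ← integral_const_mul]
      congr 1 with x
      simp; ring)
  let F : V →ₗ[ℝ] ℝ :=
    { toFun := fun p => ∫ x, g x * polyVal p.1 x ∂μ
      map_add' := fun p p' => by
        rw [← integral_add (hμ _ (by fun_prop)) (hμ _ (by fun_prop))]
        congr 1 with x
        simp; ring
      map_smul' := fun a p => by
        rw [RingHom.id_apply, smul_eq_mul, ← integral_const_mul]
        congr 1 with x
        simp; ring }
  obtain ⟨r, hr⟩ := exists_form_eq B (fun r p => by
      change ∫ x, _ ∂μ = ∫ x, _ ∂μ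
      congr 1 with x
      ring) F fun p hp => h p.1 p.2 hp
  exact ⟨r.1, r.2, fun p hp => hr ⟨p, hp⟩⟩

/-- A polynomial that vanishes on a short initial piece of a ray vanishes on the ray. -/
theorem polyVal_eq_zero_of_eventually {p : MvPolynomial (Fin d) ℝ}
    {x y : EuclideanSpace ℝ (Fin d)}
    (h : ∀ᶠ s in nhdsWithin (0 : ℝ) (Set.Ioi 0), polyVal p (x + s • (y - x)) = 0) :
    polyVal p y = 0 := by
  obtain ⟨ε, hε, hsub⟩ := mem_nhdsGT_iff_exists_Ioc_subset.1 h
  obtain ⟨C, -, hC⟩ := IsPolyOnLines.exists_sq_le p.totalDegree hε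
  have := hC _ (isPolyOnLines_polyVal le_rfl) x y 0 fun s h0 h1 => by
    rw [show polyVal p (x + s • (y - x)) = 0 from hsub ⟨h0, h1⟩]; simp
  rw [mul_zero] at this
  exact pow_eq_zero_iff two_ne_zero |>.1 (le_antisymm this (sq_nonneg _))

end Galerkin

namespace ConvexPolytope

variable {d n : ℕ} (T : ConvexPolytope d n) (i : Fin n)

/-- The affine polynomial that vanishes on the hyperplane of a facet, with unit normal
derivative. -/
def facetPoly : MvPolynomial (Fin d) ℝ := affPoly (-T.offset i) (T.normal i)

@[simp] theorem polyVal_facetPoly (x : EuclideanSpace ℝ (Fin d)) :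
    polyVal (T.facetPoly i) x = -T.gap i x := by
  rw [facetPoly, polyVal_affPoly, gap]; ring

theorem polyDeriv_facetPoly : polyDeriv (T.normal i) (T.facetPoly i) = 1 := by
  rw [facetPoly, polyDeriv_affPoly, inner_normal_self, map_one]

theorem totalDegree_facetPoly_mul_le {m : ℕ} {p : MvPolynomial (Fin d) ℝ}
    (hp : p.totalDegree ≤ m) : (T.facetPoly i * p).totalDegree ≤ m + 1 :=
  (MvPolynomial.totalDegree_mul _ _).trans
    ((add_le_add (totalDegree_affPoly_le _ _) hp).trans (add_comm _ _).le)

/-- The squared product of the weights. -/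
def bubble (i : Fin n) (lam : Fin n → MvPolynomial (Fin d) ℝ) : MvPolynomial (Fin d) ℝ :=
  ∏ j ∈ Finset.univ.erase i, lam j ^ 2

theorem polyVal_bubble (lam : Fin n → MvPolynomial (Fin d) ℝ) (x : EuclideanSpace ℝ (Fin d)) :
    polyVal (bubble i lam) x = ∏ j ∈ Finset.univ.erase i, polyVal (lam j) x ^ 2 := by
  simp [bubble]

theorem polyVal_bubble_nonneg (lam : Fin n → MvPolynomial (Fin d) ℝ)
    (x : EuclideanSpace ℝ (Fin d)) : 0 ≤ polyVal (bubble i lam) x := by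
  rw [polyVal_bubble]
  exact Finset.prod_nonneg fun j _ => sq_nonneg _

theorem le_polyVal_bubble {lam : Fin n → MvPolynomial (Fin d) ℝ} {x : EuclideanSpace ℝ (Fin d)}
    {a : ℝ} (ha : 0 ≤ a) (h : ∀ j, j ≠ i → a ≤ polyVal (lam j) x) :
    (a ^ 2) ^ (n - 1) ≤ polyVal (bubble i lam) x := by
  rw [polyVal_bubble]
  calc (a ^ 2) ^ (n - 1) = ∏ _j ∈ Finset.univ.erase i, a ^ 2 := by
        rw [Finset.prod_const, Finset.card_erase_of_mem (Finset.mem_univ _), Finset.card_univ,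
          Fintype.card_fin]
    _ ≤ _ := Finset.prod_le_prod (fun _ _ => sq_nonneg _) fun j hj =>
        pow_le_pow_left₀ ha (h j (Finset.ne_of_mem_erase hj)) 2

theorem polyVal_bubble_le {lam : Fin n → MvPolynomial (Fin d) ℝ} {x : EuclideanSpace ℝ (Fin d)}
    {a : ℝ} (h : ∀ j, j ≠ i → polyVal (lam j) x ^ 2 ≤ a) :
    polyVal (bubble i lam) x ≤ a ^ (n - 1) := by
  rw [polyVal_bubble]
  calc _ ≤ ∏ _j ∈ Finset.univ.erase i, a := Finset.prod_le_prod (fun _ _ => sq_nonneg _)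
        fun j hj => h j (Finset.ne_of_mem_erase hj)
    _ = _ := by
        rw [Finset.prod_const, Finset.card_erase_of_mem (Finset.mem_univ _), Finset.card_univ,
          Fintype.card_fin]

theorem integrable_carrier {f : EuclideanSpace ℝ (Fin d) → ℝ} (hf : Continuous f) :
    Integrable f (volume.restrict T.carrier) :=
  hf.continuousOn.integrableOn_compact T.isCompact_carrier

theorem integrable_face (hd : 1 ≤ d) {f : EuclideanSpace ℝ (Fin d) → ℝ} (hf : Continuous f) :
    Integrable f (T.surfaceMeasure i) := by
  obtain ⟨c⟩ := T.nonempty_facetChart i hd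
  exact c.integrable_surfaceMeasure hf

theorem FacetChart.isPolyOnLines_comp {T : ConvexPolytope d n} {i : Fin n} (c : FacetChart T i)
    {k : ℕ} {f : EuclideanSpace ℝ (Fin d) → ℝ} (hf : IsPolyOnLines k f) :
    IsPolyOnLines k fun y => f (c.map y) := by
  intro x v
  obtain ⟨P, hP, h⟩ := hf (c.map x) (c.dir v)
  refine ⟨P, hP, fun t => ?_⟩
  simp only [← h, FacetChart.map, map_add, map_smul, add_assoc]

theorem integral_face_congr (hd : 1 ≤ d) {f g : EuclideanSpace ℝ (Fin d) → ℝ}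
    (h : ∀ x ∈ T.face i, f x = g x) :
    ∫ x, f x ∂(T.surfaceMeasure i) = ∫ x, g x ∂(T.surfaceMeasure i) := by
  obtain ⟨c⟩ := T.nonempty_facetChart i hd
  rw [c.integral_surfaceMeasure, c.integral_surfaceMeasure]
  exact setIntegral_congr_fun c.isCompact_dom.isClosed.measurableSet fun y hy => h _ hy

theorem integral_face_mono (hd : 1 ≤ d) {f g : EuclideanSpace ℝ (Fin d) → ℝ} (hf : Continuous f)
    (hg : Continuous g) (h : ∀ x ∈ T.face i, f x ≤ g x) :
    ∫ x, f x ∂(T.surfaceMeasure i) ≤ ∫ x, g x ∂(T.surfaceMeasure i) := by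
  obtain ⟨c⟩ := T.nonempty_facetChart i hd
  rw [c.integral_surfaceMeasure, c.integral_surfaceMeasure]
  have := c.continuous_map
  exact setIntegral_mono_on
    ((hf.comp this).continuousOn.integrableOn_compact c.isCompact_dom)
    ((hg.comp this).continuousOn.integrableOn_compact c.isCompact_dom)
    c.isCompact_dom.isClosed.measurableSet fun y hy => h _ hy

theorem IsWeightFamily.half_le_on_face {T : ConvexPolytope d n} {i : Fin n}
    {lam : Fin n → MvPolynomial (Fin d) ℝ} (h : T.IsWeightFamily i lam) (hd : 1 ≤ d)
    {x : EuclideanSpace ℝ (Fin d)} (hx : x ∈ T.face i) {j : Fin n} (hj : j ≠ i) :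
    1 / 2 ≤ polyVal (lam j)
      (T.faceBarycenter i + (1 / 2 : ℝ) • (x - T.faceBarycenter i)) := by
  have hpos := T.gap_faceBarycenter_pos hd hj
  rw [h.polyVal_eq hd hj, gap_add_smul_sub, le_div_iff₀ hpos]
  have := ((T.mem_face_iff i).1 hx).1 j
  linarith

/-- Coercivity of the bubble weight on polynomials on a facet. -/
theorem exists_face_coercive (d n k : ℕ) (hd : 1 ≤ d) :
    ∃ C : ℝ, 0 < C ∧ ∀ (T : ConvexPolytope d n) (i : Fin n)
      (lam : Fin n → MvPolynomial (Fin d) ℝ), T.IsWeightFamily i lam →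
      ∀ p : MvPolynomial (Fin d) ℝ, p.totalDegree ≤ k →
        ∫ x, polyVal p x ^ 2 ∂(T.surfaceMeasure i) ≤
          C * ∫ x, polyVal (bubble i lam) x * polyVal p x ^ 2 ∂(T.surfaceMeasure i) := by
  obtain ⟨C, hC, h⟩ := exists_integral_sq_le_weighted (d - 1) k
  set w₀ : ℝ := ((1 / 2 : ℝ) ^ 2) ^ (n - 1) with hw₀
  have hw₀pos : 0 < w₀ := by positivity
  refine ⟨C / w₀, by positivity, fun T i lam hlam p hp => ?_⟩
  obtain ⟨c⟩ := T.nonempty_facetChart i hd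
  obtain ⟨z, hz⟩ := c.exists_map_eq (T.gap_faceBarycenter_self i hd)
  rw [c.integral_surfaceMeasure, c.integral_surfaceMeasure, div_mul_eq_mul_div,
    le_div_iff₀ hw₀pos, mul_comm]
  refine h c.dom z (fun y => polyVal p (c.map y)) (fun y => polyVal (bubble i lam) (c.map y)) w₀
    c.isCompact_dom c.convex_dom ?_ (c.isPolyOnLines_comp (isPolyOnLines_polyVal hp))
    (by fun_prop) (by fun_prop) (fun y _ => polyVal_bubble_nonneg i lam _) fun y hy => ?_
  · change c.map z ∈ T.face i
    rw [hz]
    exact T.faceBarycenter_mem_face i hd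
  · rw [c.map_add_smul_sub, hz]
    exact le_polyVal_bubble i (by norm_num) fun j hj => hlam.half_le_on_face hd hy hj

/-- Coercivity of the bubble weight times the squared distance to a facet on polynomials on
the polytope. -/
theorem exists_carrier_coercive (d n k : ℕ) (hd : 1 ≤ d) :
    ∃ C : ℝ, 0 < C ∧ ∀ (T : ConvexPolytope d n) (i : Fin n)
      (lam : Fin n → MvPolynomial (Fin d) ℝ), T.IsWeightFamily i lam →
      ∀ σ : ℝ, 0 < σ → T.faceBarycenter i - σ • T.normal i ∈ T.carrier →
      ∀ p : MvPolynomial (Fin d) ℝ, p.totalDegree ≤ k →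
        σ ^ 2 * ∫ x in T.carrier, polyVal p x ^ 2 ≤
          C * ∫ x in T.carrier, polyVal (bubble i lam) x * T.gap i x ^ 2 * polyVal p x ^ 2 := by
  obtain ⟨C, hC, h⟩ := exists_integral_sq_le_weighted d k
  set w₀ : ℝ := ((1 / 4 : ℝ) ^ 2) ^ (n - 1) with hw₀
  have hw₀pos : 0 < w₀ := by positivity
  refine ⟨16 * C / w₀, by positivity, fun T i lam hlam σ hσ hσm p hp => ?_⟩
  set m := T.faceBarycenter i with hm
  have hgσ : ∀ j, T.gap j (m - (σ / 2) • T.normal i) =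
      1 / 2 * T.gap j m + 1 / 2 * T.gap j (m - σ • T.normal i) := fun j => by
    rw [gap_sub_smul_normal, gap_sub_smul_normal]; ring
  have hgi : T.gap i m = 0 := T.gap_faceBarycenter_self i hd
  have hmT := T.face_subset_carrier i (T.faceBarycenter_mem_face i hd)
  have hgσi : T.gap i (m - σ • T.normal i) = σ := by
    rw [gap_sub_smul_normal, hgi, inner_normal_self]; ring
  have hx₀ : m - (σ / 2) • T.normal i ∈ T.carrier := T.mem_carrier_iff.2 fun j => by
    have h1 := T.mem_carrier_iff.1 hmT j
    have h2 := T.mem_carrier_iff.1 hσm j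
    rw [hgσ]
    rw [← hm] at h1
    linarith
  have key := h T.carrier (m - (σ / 2) • T.normal i) (polyVal p)
    (fun x => polyVal (bubble i lam) x * T.gap i x ^ 2) (w₀ * (σ / 4) ^ 2)
    T.isCompact_carrier T.convex_carrier hx₀ (isPolyOnLines_polyVal hp) (by fun_prop) (by fun_prop)
    (fun x _ => mul_nonneg (polyVal_bubble_nonneg i lam x) (sq_nonneg _)) fun x hx => by
      refine mul_le_mul (le_polyVal_bubble i (by norm_num) fun j hj => ?_)
        (pow_le_pow_left₀ (by positivity) ?_ 2) (sq_nonneg _) (polyVal_bubble_nonneg i lam _)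
      · have hpos := T.gap_faceBarycenter_pos hd hj
        rw [hlam.polyVal_eq hd hj, gap_add_smul_sub, hgσ, le_div_iff₀ hpos]
        have h1 := T.mem_carrier_iff.1 hx j
        have h2 := T.mem_carrier_iff.1 hσm j
        rw [← hm]
        linarith
      · rw [gap_add_smul_sub, hgσ, hgi, hgσi]
        have h1 := T.mem_carrier_iff.1 hx i
        linarith
  rw [div_mul_eq_mul_div, le_div_iff₀ hw₀pos]
  linarith

/-- A polynomial with vanishing `L²` norm on a facet vanishes on the hyperplane of the facet. -/
theorem polyVal_eq_zero_of_integral_face (hd : 1 ≤ d) {p : MvPolynomial (Fin d) ℝ}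
    (h : ∫ x, polyVal p x ^ 2 ∂(T.surfaceMeasure i) ≤ 0) {x : EuclideanSpace ℝ (Fin d)}
    (hx : T.gap i x = 0) : polyVal p x = 0 := by
  obtain ⟨c⟩ := T.nonempty_facetChart i hd
  obtain ⟨C, hC, hsup⟩ := exists_volume_mul_sq_le (d - 1) p.totalDegree
  rw [c.integral_surfaceMeasure] at h
  have hface : ∀ z ∈ T.face i, polyVal p z = 0 := by
    intro z hz
    obtain ⟨y, rfl⟩ := c.exists_map_eq ((T.mem_face_iff i).1 hz).2
    have h1 := hsup c.dom (fun y => polyVal p (c.map y)) c.isCompact_dom c.convex_dom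
      (c.isPolyOnLines_comp (isPolyOnLines_polyVal le_rfl)) (by fun_prop) y hz
    have h2 : volume.real c.dom * polyVal p (c.map y) ^ 2 ≤ 0 :=
      h1.trans (mul_nonpos_of_nonneg_of_nonpos hC.le h)
    have h3 := nonpos_of_mul_nonpos_right h2 c.volume_dom_pos
    exact pow_eq_zero_iff two_ne_zero |>.1 (le_antisymm h3 (sq_nonneg _))
  refine polyVal_eq_zero_of_eventually (x := T.faceBarycenter i) ?_
  have hev : ∀ᶠ t in nhds (0 : ℝ), ∀ l, l ≠ i →
      0 < T.gap l (T.faceBarycenter i + t • (x - T.faceBarycenter i)) := by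
    refine Filter.eventually_all.2 fun l => Filter.eventually_imp_distrib_left.2 fun hl => ?_
    have hc : Continuous fun t : ℝ =>
      T.gap l (T.faceBarycenter i + t • (x - T.faceBarycenter i)) := by fun_prop
    exact hc.continuousAt.eventually
      (lt_mem_nhds (by simpa using T.gap_faceBarycenter_pos hd hl))
  filter_upwards [hev.filter_mono nhdsWithin_le_nhds] with t ht
  have hi : T.gap i (T.faceBarycenter i + t • (x - T.faceBarycenter i)) = 0 := by
    rw [gap_add_smul_sub, hx, T.gap_faceBarycenter_self i hd]; ring
  refine hface _ ((T.mem_face_iff i).2 ⟨fun l => ?_, hi⟩)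
  by_cases hl : l = i
  · rw [hl, hi]
  · exact (ht l hl).le

/-- A polynomial with vanishing `L²` norm on a polytope is zero. -/
theorem eq_zero_of_integral_carrier {p : MvPolynomial (Fin d) ℝ}
    (h : ∫ x in T.carrier, polyVal p x ^ 2 ≤ 0) : p = 0 := by
  obtain ⟨C, hC, hsup⟩ := exists_volume_mul_sq_le d p.totalDegree
  obtain ⟨x₀, hx₀⟩ := T.interior_nonempty
  have hx₀ : ∀ l, 0 < T.gap l x₀ := fun l => by simpa [gap] using hx₀ l
  have hopen : IsOpen {x | ∀ l, 0 < T.gap l x} := by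
    simp only [Set.ofPred_forall]
    exact isOpen_iInter_of_finite fun j => isOpen_lt continuous_const (by fun_prop)
  have hsub : {x | ∀ l, 0 < T.gap l x} ⊆ T.carrier := fun x hx =>
    T.mem_carrier_iff.2 fun l => (hx l).le
  have hvol : 0 < volume.real T.carrier :=
    ENNReal.toReal_pos ((hopen.measure_pos volume ⟨x₀, hx₀⟩).trans_le (measure_mono hsub)).ne'
      T.isCompact_carrier.measure_lt_top.ne
  have hzero : ∀ z ∈ T.carrier, polyVal p z = 0 := by
    intro z hz
    have h1 := hsup T.carrier (polyVal p) T.isCompact_carrier T.convex_carrier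
      (isPolyOnLines_polyVal le_rfl) (by fun_prop) z hz
    have h3 := nonpos_of_mul_nonpos_right (h1.trans (mul_nonpos_of_nonneg_of_nonpos hC.le h)) hvol
    exact pow_eq_zero_iff two_ne_zero |>.1 (le_antisymm h3 (sq_nonneg _))
  refine polyVal_injective (funext fun y => ?_)
  rw [polyVal_zero]
  refine polyVal_eq_zero_of_eventually (x := x₀) ?_
  have hev : ∀ᶠ t in nhds (0 : ℝ), ∀ l, 0 < T.gap l (x₀ + t • (y - x₀)) := by
    refine Filter.eventually_all.2 fun l => ?_
    have hc : Continuous fun t : ℝ => T.gap l (x₀ + t • (y - x₀)) := by fun_prop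
    exact hc.continuousAt.eventually (lt_mem_nhds (by simpa using hx₀ l))
  filter_upwards [hev.filter_mono nhdsWithin_le_nhds] with t ht
  exact hzero _ (hsub ht)

end ConvexPolytope

namespace ConvexPolytope

variable {d n : ℕ} {T : ConvexPolytope d n} {i : Fin n} {lam : Fin n → MvPolynomial (Fin d) ℝ}
  {k : ℕ} {g q : MvPolynomial (Fin d) ℝ}

theorem gap_of_mem_face {x : EuclideanSpace ℝ (Fin d)} (hx : x ∈ T.face i) : T.gap i x = 0 :=
  ((T.mem_face_iff i).1 hx).2

/-- On the facet, the normal derivative of an expansion in powers of the facet polynomial. -/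
theorem polyDirDeriv_expansion (w r₀ s t : MvPolynomial (Fin d) ℝ) {x : EuclideanSpace ℝ (Fin d)}
    (hx : x ∈ T.face i) :
    polyDirDeriv (w * (r₀ + T.facetPoly i * s + T.facetPoly i ^ 2 * t)) (T.normal i) x =
      polyVal (polyDeriv (T.normal i) (w * r₀)) x + polyVal w x * polyVal s x := by
  rw [← polyVal_polyDeriv]
  simp [Derivation.leibniz, Derivation.leibniz_pow, polyDeriv_facetPoly, gap_of_mem_face hx]
  ring

theorem exists_isBubbleExtension (hd : 1 ≤ d) (hk : 1 ≤ k) (hlam : T.IsWeightFamily i lam)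
    (g : MvPolynomial (Fin d) ℝ) : ∃ q, T.IsBubbleExtension i lam k g q := by
  set w := bubble i lam with hw
  have hdeg : ∀ {m : ℕ} {p : MvPolynomial (Fin d) ℝ}, p ∈ PolyDeg d m ↔ p.totalDegree ≤ m :=
    MvPolynomial.mem_restrictTotalDegree _ _ _
  have hface : ∀ (m : ℕ) (f : EuclideanSpace ℝ (Fin d) → ℝ), ∀ p ∈ PolyDeg d m,
      ∫ x, polyVal w x * polyVal p x * polyVal p x ∂(T.surfaceMeasure i) = 0 →
      ∫ x, f x * polyVal p x ∂(T.surfaceMeasure i) = 0 := by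
    intro m f p hp h0
    obtain ⟨C, hC, h⟩ := exists_face_coercive d n m hd
    have h1 := h T i lam hlam p (hdeg.1 hp)
    simp only [mul_assoc, ← pow_two] at h0
    rw [h0, mul_zero] at h1
    rw [T.integral_face_congr i hd (g := fun _ => 0) fun x hx => by
      rw [T.polyVal_eq_zero_of_integral_face i hd h1 (gap_of_mem_face hx), mul_zero]]
    simp
  obtain ⟨r₀, hr₀, h₀⟩ := exists_galerkin (PolyDeg d (k + 1)) (μ := T.surfaceMeasure i)
    (fun f hf => T.integrable_face i hd hf) (continuous_polyVal w) (continuous_polyVal g)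
    (hface _ _)
  obtain ⟨s, hs, h₁⟩ := exists_galerkin (PolyDeg d k) (μ := T.surfaceMeasure i)
    (fun f hf => T.integrable_face i hd hf) (continuous_polyVal w)
    (continuous_polyVal (-polyDeriv (T.normal i) (w * r₀))) (hface _ _)
  obtain ⟨t, ht, h₂⟩ := exists_galerkin (PolyDeg d (k - 1)) (μ := volume.restrict T.carrier)
    (fun f hf => T.integrable_carrier hf)
    (continuous_polyVal (w * T.facetPoly i ^ 2))
    (continuous_polyVal (-(w * (r₀ + T.facetPoly i * s)))) (by
      intro p hp h0
      obtain ⟨C, hC, h⟩ := exists_carrier_coercive d n (k - 1) hd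
      obtain ⟨σ, hσ, hσm, -⟩ := T.exists_height i hd
      have h1 := h T i lam hlam σ hσ hσm p (hdeg.1 hp)
      simp only [polyVal_mul, polyVal_pow, polyVal_facetPoly, neg_sq, mul_assoc, ← pow_two] at h0 h1
      rw [h0, mul_zero] at h1
      rw [T.eq_zero_of_integral_carrier (nonpos_of_mul_nonpos_right h1 (by positivity))]
      simp)
  refine ⟨w * (r₀ + T.facetPoly i * s + T.facetPoly i ^ 2 * t), ⟨_, ?_, rfl⟩, fun p hp => ?_,
    fun p hp => ?_, fun p hp => ?_⟩
  · refine add_mem (add_mem hr₀ (hdeg.2 (T.totalDegree_facetPoly_mul_le i (hdeg.1 hs)))) (hdeg.2 ?_)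
    rw [pow_two, mul_assoc]
    refine (T.totalDegree_facetPoly_mul_le i
      (T.totalDegree_facetPoly_mul_le i (hdeg.1 ht))).trans ?_
    omega
  · have h3 := h₂ p hp
    rw [← sub_eq_zero, ← integral_sub (T.integrable_carrier (by fun_prop))
      (T.integrable_carrier (by fun_prop))] at h3
    rw [← h3]
    congr 1 with x
    simp
    ring
  · have h3 := h₁ p hp
    rw [← sub_eq_zero, ← integral_sub (T.integrable_face i hd (by fun_prop))
      (T.integrable_face i hd (by fun_prop))] at h3
    rw [← h3]
    refine T.integral_face_congr i hd fun x hx => ?_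
    rw [polyDirDeriv_expansion w r₀ s t hx, polyVal_neg]
    ring
  · have h3 := h₀ p hp
    rw [← sub_eq_zero, ← integral_sub (T.integrable_face i hd (by fun_prop))
      (T.integrable_face i hd (by fun_prop))] at h3
    rw [← h3]
    refine T.integral_face_congr i hd fun x hx => ?_
    simp [gap_of_mem_face hx]
    ring

/-- A bubble extension, expanded in powers of the facet polynomial with leading coefficients that
are constant in the normal direction. -/
structure IsExpansion (T : ConvexPolytope d n) (i : Fin n) (lam : Fin n → MvPolynomial (Fin d) ℝ)
    (k : ℕ) (g q r₀ s t : MvPolynomial (Fin d) ℝ) : Prop where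
  eq : q = bubble i lam * (r₀ + T.facetPoly i * s + T.facetPoly i ^ 2 * t)
  degree₀ : r₀.totalDegree ≤ k + 1
  degree₁ : s.totalDegree ≤ k
  degree₂ : t.totalDegree ≤ k - 1
  proj₀ : ∀ x, polyVal r₀ x = polyVal r₀ (x + T.gap i x • T.normal i)
  proj₁ : ∀ x, polyVal s x = polyVal s (x + T.gap i x • T.normal i)
  trace : ∫ x, polyVal (bubble i lam) x * polyVal r₀ x ^ 2 ∂(T.surfaceMeasure i) =
    ∫ x, polyVal g x * polyVal r₀ x ∂(T.surfaceMeasure i)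
  normal_deriv : ∫ x, polyVal (bubble i lam) x * polyVal s x ^ 2 ∂(T.surfaceMeasure i) =
    ∫ x, -(polyVal (polyDeriv (T.normal i) (bubble i lam)) x * polyVal r₀ x) * polyVal s x
      ∂(T.surfaceMeasure i)
  orthogonal : ∫ x in T.carrier, polyVal (bubble i lam) x * T.gap i x ^ 2 * polyVal t x ^ 2 =
    ∫ x in T.carrier, -(polyVal (bubble i lam) x * (polyVal r₀ x - T.gap i x * polyVal s x)) *
      polyVal t x

theorem polyVal_projPoly_facet (p : MvPolynomial (Fin d) ℝ) (x : EuclideanSpace ℝ (Fin d)) :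
    polyVal (projPoly (-T.offset i) (T.normal i) p) x =
      polyVal p (x + T.gap i x • T.normal i) := by
  rw [polyVal_projPoly, sub_eq_add_neg, ← neg_smul]
  congr 3
  rw [gap]; ring

theorem polyVal_projPoly_facet_self (p : MvPolynomial (Fin d) ℝ) (x : EuclideanSpace ℝ (Fin d)) :
    polyVal (projPoly (-T.offset i) (T.normal i) p) x =
      polyVal (projPoly (-T.offset i) (T.normal i) p) (x + T.gap i x • T.normal i) := by
  rw [polyVal_projPoly_facet, polyVal_projPoly_facet, T.gap_proj i x, zero_smul, add_zero]

theorem IsBubbleExtension.exists_isExpansion (hd : 1 ≤ d) (hk : 1 ≤ k)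
    (h : T.IsBubbleExtension i lam k g q) : ∃ r₀ s t, T.IsExpansion i lam k g q r₀ s t := by
  obtain ⟨⟨r, hr, hqr⟩, horth, hder, htr⟩ := h
  have hdeg : ∀ {m : ℕ} {p : MvPolynomial (Fin d) ℝ}, p ∈ PolyDeg d m ↔ p.totalDegree ≤ m :=
    MvPolynomial.mem_restrictTotalDegree _ _ _
  have hr := hdeg.1 hr
  obtain ⟨u, hu, hru⟩ := exists_eq_projPoly_add (-T.offset i) (u := T.normal i) hr
  obtain ⟨l, rfl⟩ : ∃ l, k = l + 1 := ⟨k - 1, by omega⟩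
  obtain ⟨t, ht, hut⟩ := exists_eq_projPoly_add (-T.offset i) (u := T.normal i) hu
  set P := projPoly (-T.offset i) (T.normal i)
  set w := bubble i lam with hw
  have hq : q = w * (P r + T.facetPoly i * P u + T.facetPoly i ^ 2 * t) := by
    rw [hqr, ← bubble, ← hw]
    congr 1
    calc r = P r + T.facetPoly i * u := hru
      _ = P r + T.facetPoly i * (P u + T.facetPoly i * t) := by
          conv_lhs => rw [hut]
          rfl
      _ = _ := by ring
  have hd0 := (totalDegree_projPoly_le (-T.offset i) (T.normal i) r).trans hr
  have hd1 := (totalDegree_projPoly_le (-T.offset i) (T.normal i) u).trans hu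
  refine ⟨P r, P u, t, hq, hd0, hd1, by simpa using ht, polyVal_projPoly_facet_self r,
    polyVal_projPoly_facet_self u, ?_, ?_, ?_⟩
  · have h1 := htr (P r) (hdeg.2 hd0)
    rw [← sub_eq_zero, ← integral_sub (T.integrable_face i hd (by fun_prop))
      (T.integrable_face i hd (by fun_prop)), ← h1]
    refine T.integral_face_congr i hd fun x hx => ?_
    rw [hq]
    simp [gap_of_mem_face hx]
    ring
  · have h1 := hder (P u) (hdeg.2 hd1)
    rw [← sub_eq_zero, ← integral_sub (T.integrable_face i hd (by fun_prop))
      (T.integrable_face i hd (by fun_prop)), ← h1]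
    refine T.integral_face_congr i hd fun x hx => ?_
    rw [hq, polyDirDeriv_expansion _ _ _ _ hx, Derivation.leibniz,
      polyDeriv_projPoly _ (T.norm_normal i)]
    simp
    ring
  · have h1 := horth t (hdeg.2 (by simpa using ht))
    rw [← sub_eq_zero, ← integral_sub (T.integrable_carrier (by fun_prop))
      (T.integrable_carrier (by fun_prop)), ← h1]
    congr 1 with x
    rw [hq]
    simp
    ring

theorem IsBubbleExtension.sub {g' q' : MvPolynomial (Fin d) ℝ} (hd : 1 ≤ d)
    (h : T.IsBubbleExtension i lam k g q) (h' : T.IsBubbleExtension i lam k g' q') :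
    T.IsBubbleExtension i lam k (g - g') (q - q') := by
  have hD : ∀ (p : MvPolynomial (Fin d) ℝ),
      polyDirDeriv p (T.normal i) = polyVal (polyDeriv (T.normal i) p) := fun p =>
    funext fun x => (polyVal_polyDeriv _ _ _).symm
  obtain ⟨⟨r, hr, hqr⟩, horth, hder, htr⟩ := h
  obtain ⟨⟨r', hr', hqr'⟩, horth', hder', htr'⟩ := h'
  refine ⟨⟨r - r', sub_mem hr hr', by rw [hqr, hqr', mul_sub]⟩, fun p hp => ?_, fun p hp => ?_,
    fun p hp => ?_⟩
  · have e := congrArg₂ (· - ·) (horth p hp) (horth' p hp)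
    simp only [sub_zero] at e
    rw [← integral_sub (T.integrable_carrier (by fun_prop))
      (T.integrable_carrier (by fun_prop))] at e
    rw [← e]
    congr 1 with x
    simp
    ring
  · have e := congrArg₂ (· - ·) (hder p hp) (hder' p hp)
    simp only [sub_zero, hD] at e
    rw [← integral_sub (T.integrable_face i hd (by fun_prop))
      (T.integrable_face i hd (by fun_prop))] at e
    rw [← e]
    congr 1 with x
    simp [hD]
    ring
  · have e := congrArg₂ (· - ·) (htr p hp) (htr' p hp)
    simp only [sub_zero] at e
    rw [← integral_sub (T.integrable_face i hd (by fun_prop))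
      (T.integrable_face i hd (by fun_prop))] at e
    rw [← e]
    congr 1 with x
    simp
    ring

theorem IsBubbleExtension.eq_zero (hd : 1 ≤ d) (hk : 1 ≤ k) (hlam : T.IsWeightFamily i lam)
    (h : T.IsBubbleExtension i lam k 0 q) : q = 0 := by
  obtain ⟨r₀, s, t, hex⟩ := h.exists_isExpansion hd hk
  have hplane : ∀ {m : ℕ} {p : MvPolynomial (Fin d) ℝ}, p.totalDegree ≤ m →
      (∀ x, polyVal p x = polyVal p (x + T.gap i x • T.normal i)) →
      ∫ x, polyVal (bubble i lam) x * polyVal p x ^ 2 ∂(T.surfaceMeasure i) = 0 → p = 0 := by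
    intro m p hp hproj h0
    obtain ⟨C, -, h⟩ := exists_face_coercive d n m hd
    have h1 := h T i lam hlam p hp
    rw [h0, mul_zero] at h1
    refine polyVal_injective (funext fun x => ?_)
    rw [hproj, T.polyVal_eq_zero_of_integral_face i hd h1 (T.gap_proj i x), polyVal_zero]
  have hr₀ : r₀ = 0 := hplane hex.degree₀ hex.proj₀ (by rw [hex.trace]; simp)
  have hs : s = 0 := hplane hex.degree₁ hex.proj₁ (by rw [hex.normal_deriv, hr₀]; simp)
  have ht : t = 0 := by
    obtain ⟨C, -, h⟩ := exists_carrier_coercive d n (k - 1) hd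
    obtain ⟨σ, hσ, hσm, -⟩ := T.exists_height i hd
    have h1 := h T i lam hlam σ hσ hσm t hex.degree₂
    rw [hex.orthogonal, hr₀, hs] at h1
    refine T.eq_zero_of_integral_carrier (nonpos_of_mul_nonpos_right (h1.trans ?_)
      (sq_pos_of_pos hσ))
    simp
  rw [hex.eq, hr₀, hs, ht]
  simp

theorem existsUnique_isBubbleExtension (hd : 1 ≤ d) (hk : 1 ≤ k) (hlam : T.IsWeightFamily i lam)
    (g : MvPolynomial (Fin d) ℝ) : ∃! q, T.IsBubbleExtension i lam k g q := by
  obtain ⟨q, hq⟩ := exists_isBubbleExtension hd hk hlam g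
  refine ⟨q, hq, fun q' hq' => sub_eq_zero.1 ?_⟩
  refine IsBubbleExtension.eq_zero hd hk hlam ?_
  simpa only [sub_self] using hq'.sub hd hq

end ConvexPolytope

theorem integral_sq_le_of_le {X : Type*} [MeasurableSpace X] {μ : Measure X} {a b : X → ℝ} {C : ℝ}
    (hC : 0 < C) (haa : Integrable (fun x => a x ^ 2) μ) (hbb : Integrable (fun x => b x ^ 2) μ)
    (hab : Integrable (fun x => b x * a x) μ) (h : ∫ x, a x ^ 2 ∂μ ≤ C * ∫ x, b x * a x ∂μ) :
    ∫ x, a x ^ 2 ∂μ ≤ C ^ 2 * ∫ x, b x ^ 2 ∂μ := by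
  have h1 := sq_mul_integral_sq_le (c := 1 / C) (by positivity) haa hbb hab (by
    rw [one_div_mul_eq_div, div_le_iff₀ hC, mul_comm]; exact h)
  rw [div_pow, one_pow, one_div_mul_eq_div, div_le_iff₀ (by positivity), mul_comm] at h1
  exact h1

namespace ConvexPolytope

variable {d n : ℕ} {T : ConvexPolytope d n} {i : Fin n} {lam : Fin n → MvPolynomial (Fin d) ℝ}

theorem integral_carrier_mono {f g : EuclideanSpace ℝ (Fin d) → ℝ} (hf : Continuous f)
    (hg : Continuous g) (h : ∀ x ∈ T.carrier, f x ≤ g x) :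
    ∫ x in T.carrier, f x ≤ ∫ x in T.carrier, g x :=
  setIntegral_mono_on (T.integrable_carrier hf) (T.integrable_carrier hg)
    T.isCompact_carrier.isClosed.measurableSet h

theorem IsWeightFamily.polyDeriv_eq (h : T.IsWeightFamily i lam) (hd : 1 ≤ d) {j : Fin n}
    (hj : j ≠ i) (v : EuclideanSpace ℝ (Fin d)) :
    polyDeriv v (lam j) =
      MvPolynomial.C (-(inner ℝ (T.normal j) v / T.gap j (T.faceBarycenter i))) := by
  have : lam j = affPoly (T.offset j / T.gap j (T.faceBarycenter i))
      (-(1 / T.gap j (T.faceBarycenter i)) • T.normal j) := by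
    refine polyVal_injective (funext fun x => ?_)
    rw [h.polyVal_eq hd hj, polyVal_affPoly, inner_smul_left, gap]
    simp
    ring
  rw [this, polyDeriv_affPoly, inner_smul_left]
  congr 1
  simp
  ring

theorem abs_polyDeriv_prod_le {ι : Type*} (s : Finset ι) (f : ι → MvPolynomial (Fin d) ℝ)
    (v x : EuclideanSpace ℝ (Fin d)) {a b : ℝ} (ha : 1 ≤ a) (hb : 0 ≤ b)
    (hf : ∀ j ∈ s, |polyVal (f j) x| ≤ a) (hf' : ∀ j ∈ s, |polyVal (polyDeriv v (f j)) x| ≤ b) :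
    |polyVal (∏ j ∈ s, f j) x| ≤ a ^ s.card ∧
      |polyVal (polyDeriv v (∏ j ∈ s, f j)) x| ≤ s.card * a ^ s.card * b := by
  classical
  have ha0 : 0 ≤ a := zero_le_one.trans ha
  induction s using Finset.induction_on with
  | empty => simp
  | insert j s hj ih =>
    obtain ⟨h1, h2⟩ := ih (fun l hl => hf l (Finset.mem_insert_of_mem hl))
      fun l hl => hf' l (Finset.mem_insert_of_mem hl)
    have h3 := hf j (Finset.mem_insert_self _ _)
    have h4 := hf' j (Finset.mem_insert_self _ _)
    rw [Finset.prod_insert hj, Finset.card_insert_of_notMem hj, Derivation.leibniz]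
    simp only [smul_eq_mul, polyVal_mul, polyVal_add, abs_mul]
    refine ⟨?_, (abs_add_le _ _).trans ?_⟩
    · rw [pow_succ, mul_comm]
      exact mul_le_mul h1 h3 (abs_nonneg _) (by positivity)
    · rw [abs_mul, abs_mul]
      calc _ ≤ a * (s.card * a ^ s.card * b) + a ^ s.card * b := by gcongr
        _ ≤ a * (s.card * a ^ s.card * b) + a ^ (s.card + 1) * b := by
            gcongr
            omega
        _ = _ := by push_cast; ring

/-- A polynomial that is constant in the normal direction is controlled by its values on the
facet. -/
theorem exists_integral_carrier_le_face (d k : ℕ) (hd : 1 ≤ d) {c Cv : ℝ} (hc : 0 < c)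
    (hCv : 0 < Cv) :
    ∃ C : ℝ, 0 < C ∧ ∀ {n : ℕ} (T : ConvexPolytope d n) (i : Fin n) (σ : ℝ), 0 < σ →
      (∀ y, T.gap i y = 0 → dist y (T.faceBarycenter i) ≤ c * Metric.diam T.carrier →
          y ∈ T.face i) →
      (∀ ch : FacetChart T i, volume.real T.carrier ≤ Cv * σ * volume.real ch.dom) →
      ∀ p : MvPolynomial (Fin d) ℝ, p.totalDegree ≤ k →
        (∀ x, polyVal p x = polyVal p (x + T.gap i x • T.normal i)) →
        ∫ x in T.carrier, polyVal p x ^ 2 ≤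
          C * σ * ∫ x, polyVal p x ^ 2 ∂(T.surfaceMeasure i) := by
  obtain ⟨S, hS, hsup⟩ := exists_volume_mul_sq_le (d - 1) k
  obtain ⟨X, hX, hext⟩ := IsPolyOnLines.exists_sq_le k hc
  refine ⟨Cv * X * S, by positivity, fun T i σ hσ hball hvol p hp hproj => ?_⟩
  obtain ⟨ch⟩ := T.nonempty_facetChart i hd
  set m := T.faceBarycenter i with hm
  set V := volume.real ch.dom with hV
  have hV0 : 0 < V := ch.volume_dom_pos
  set F := ∫ x, polyVal p x ^ 2 ∂(T.surfaceMeasure i) with hF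
  have hF0 : 0 ≤ F := integral_nonneg fun x => sq_nonneg _
  have hface : ∀ z ∈ T.face i, polyVal p z ^ 2 ≤ S * F / V := by
    intro z hz
    obtain ⟨y, rfl⟩ := ch.exists_map_eq (gap_of_mem_face hz)
    have h1 := hsup ch.dom (fun y => polyVal p (ch.map y)) ch.isCompact_dom ch.convex_dom
      (ch.isPolyOnLines_comp (isPolyOnLines_polyVal hp)) (by fun_prop) y hz
    rw [le_div_iff₀ hV0, hF, ch.integral_surfaceMeasure, mul_comm]
    exact h1
  have hT : ∀ x ∈ T.carrier, polyVal p x ^ 2 ≤ X * (S * F / V) := by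
    intro x hx
    rw [hproj]
    refine hext _ (isPolyOnLines_polyVal hp) m _ _ fun s hs0 hs1 => hface _ (hball _ ?_ ?_)
    · rw [gap_add_smul_sub, T.gap_proj i x, T.gap_faceBarycenter_self i hd]; ring
    · rw [dist_self_add_left, norm_smul, ← dist_eq_norm, Real.norm_of_nonneg hs0.le]
      exact mul_le_mul hs1 (T.dist_proj_faceBarycenter_le i hd hx) dist_nonneg hc.le
  calc ∫ x in T.carrier, polyVal p x ^ 2 ≤ ∫ _x in T.carrier, X * (S * F / V) :=
        integral_carrier_mono (by fun_prop) continuous_const hT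
    _ = volume.real T.carrier * (X * (S * F / V)) := by simp
    _ ≤ Cv * σ * V * (X * (S * F / V)) := by
        gcongr
        exact hvol ch
    _ = _ := by field_simp

theorem IsWeightFamily.abs_polyVal_le (hlam : T.IsWeightFamily i lam) (hd : 1 ≤ d) {Λ : ℝ}
    (hgap : ∀ j, j ≠ i → ∀ x ∈ T.carrier, T.gap j x ≤ Λ * T.gap j (T.faceBarycenter i))
    {j : Fin n} (hj : j ≠ i) {x : EuclideanSpace ℝ (Fin d)} (hx : x ∈ T.carrier) :
    |polyVal (lam j) x| ≤ Λ := by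
  have hpos := T.gap_faceBarycenter_pos hd hj
  rw [hlam.polyVal_eq hd hj, abs_of_nonneg (div_nonneg (T.mem_carrier_iff.1 hx j) hpos.le),
    div_le_iff₀ hpos]
  exact hgap j hj x hx

theorem IsWeightFamily.polyVal_bubble_le (hlam : T.IsWeightFamily i lam) (hd : 1 ≤ d) {Λ : ℝ}
    (hgap : ∀ j, j ≠ i → ∀ x ∈ T.carrier, T.gap j x ≤ Λ * T.gap j (T.faceBarycenter i))
    {x : EuclideanSpace ℝ (Fin d)} (hx : x ∈ T.carrier) :
    polyVal (bubble i lam) x ≤ (Λ ^ 2 + 1) ^ (n - 1) :=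
  ConvexPolytope.polyVal_bubble_le i fun j hj => by
    rw [← sq_abs]
    have := pow_le_pow_left₀ (abs_nonneg _) (hlam.abs_polyVal_le hd hgap hj hx) 2
    linarith

theorem IsWeightFamily.abs_polyDeriv_bubble_le (hlam : T.IsWeightFamily i lam) (hd : 1 ≤ d)
    {A Λ σ : ℝ} (hA : 0 < A) (hΛ : 0 < Λ) (hσ : 0 < σ)
    (hgap : ∀ j, j ≠ i → ∀ x ∈ T.carrier, T.gap j x ≤ Λ * T.gap j (T.faceBarycenter i))
    (hinner : ∀ j, j ≠ i → |inner ℝ (T.normal j) (T.normal i)| * σ ≤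
      A * T.gap j (T.faceBarycenter i))
    {x : EuclideanSpace ℝ (Fin d)} (hx : x ∈ T.carrier) :
    |polyVal (polyDeriv (T.normal i) (bubble i lam)) x| ≤
      (n - 1 : ℕ) * (Λ ^ 2 + 1) ^ (n - 1) * (2 * Λ * A) / σ := by
  have h1 := (abs_polyDeriv_prod_le (Finset.univ.erase i) (fun j => lam j ^ 2) (T.normal i) x
    (a := Λ ^ 2 + 1) (b := 2 * (Λ * (A / σ))) (by nlinarith) (by positivity)
    (fun j hj => by
      have := pow_le_pow_left₀ (abs_nonneg _)
        (hlam.abs_polyVal_le hd hgap (Finset.ne_of_mem_erase hj) hx) 2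
      rw [polyVal_pow, abs_pow]
      linarith)
    (fun j hj => by
      have hji := Finset.ne_of_mem_erase hj
      have hpos := T.gap_faceBarycenter_pos hd hji
      have h2 : |inner ℝ (T.normal j) (T.normal i) / T.gap j (T.faceBarycenter i)| ≤ A / σ := by
        rw [abs_div, abs_of_pos hpos, div_le_div_iff₀ hpos hσ]
        exact hinner j hji
      rw [pow_two, Derivation.leibniz, hlam.polyDeriv_eq hd hji, smul_eq_mul, polyVal_add,
        ← two_mul, polyVal_mul, polyVal_C, abs_mul, abs_mul, abs_neg, abs_two]
      exact mul_le_mul_of_nonneg_left (mul_le_mul (hlam.abs_polyVal_le hd hgap hji hx) h2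
        (abs_nonneg _) hΛ.le) zero_le_two)).2
  rw [Finset.card_erase_of_mem (Finset.mem_univ _), Finset.card_univ, Fintype.card_fin] at h1
  refine h1.trans_eq ?_
  ring

namespace IsExpansion

variable {k : ℕ} {g q r₀ s t : MvPolynomial (Fin d) ℝ}

theorem integral_trace_le (hex : T.IsExpansion i lam k g q r₀ s t) (hd : 1 ≤ d) {F : ℝ}
    (hF : 0 < F) (h : ∫ x, polyVal r₀ x ^ 2 ∂(T.surfaceMeasure i) ≤
      F * ∫ x, polyVal (bubble i lam) x * polyVal r₀ x ^ 2 ∂(T.surfaceMeasure i)) :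
    ∫ x, polyVal r₀ x ^ 2 ∂(T.surfaceMeasure i) ≤
      F ^ 2 * ∫ x, polyVal g x ^ 2 ∂(T.surfaceMeasure i) :=
  integral_sq_le_of_le hF (T.integrable_face i hd (by fun_prop))
    (T.integrable_face i hd (by fun_prop)) (T.integrable_face i hd (by fun_prop))
    (hex.trace ▸ h)

theorem integral_normal_deriv_le (hex : T.IsExpansion i lam k g q r₀ s t) (hd : 1 ≤ d) {F D : ℝ}
    (hF : 0 < F) (h : ∫ x, polyVal s x ^ 2 ∂(T.surfaceMeasure i) ≤
      F * ∫ x, polyVal (bubble i lam) x * polyVal s x ^ 2 ∂(T.surfaceMeasure i))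
    (hD : ∀ x ∈ T.carrier, |polyVal (polyDeriv (T.normal i) (bubble i lam)) x| ≤ D) :
    ∫ x, polyVal s x ^ 2 ∂(T.surfaceMeasure i) ≤
      F ^ 2 * (D ^ 2 * ∫ x, polyVal r₀ x ^ 2 ∂(T.surfaceMeasure i)) := by
  rw [hex.normal_deriv] at h
  refine (integral_sq_le_of_le hF (T.integrable_face i hd (by fun_prop))
    (T.integrable_face i hd (by fun_prop)) (T.integrable_face i hd (by fun_prop)) h).trans ?_
  refine mul_le_mul_of_nonneg_left ?_ (by positivity)
  rw [← integral_const_mul]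
  refine T.integral_face_mono i hd (by fun_prop) (by fun_prop) fun x hx => ?_
  rw [neg_sq, mul_pow]
  refine mul_le_mul_of_nonneg_right ?_ (sq_nonneg _)
  rw [← sq_abs]
  exact pow_le_pow_left₀ (abs_nonneg _) (hD x hx.1) 2

theorem integral_orthogonal_le (hex : T.IsExpansion i lam k g q r₀ s t) {F W σ : ℝ}
    (hF : 0 < F) (hσ : 0 < σ) (h : σ ^ 2 * ∫ x in T.carrier, polyVal t x ^ 2 ≤
      F * ∫ x in T.carrier, polyVal (bubble i lam) x * T.gap i x ^ 2 * polyVal t x ^ 2)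
    (hW : ∀ x ∈ T.carrier, polyVal (bubble i lam) x ≤ W) :
    σ ^ 4 * ∫ x in T.carrier, polyVal t x ^ 2 ≤
      F ^ 2 * W ^ 2 * ∫ x in T.carrier, (polyVal r₀ x - T.gap i x * polyVal s x) ^ 2 := by
  rw [hex.orthogonal] at h
  have h2 := integral_sq_le_of_le (C := F / σ ^ 2) (a := polyVal t)
    (b := fun x => -(polyVal (bubble i lam) x * (polyVal r₀ x - T.gap i x * polyVal s x)))
    (by positivity) (T.integrable_carrier (by fun_prop)) (T.integrable_carrier (by fun_prop))
    (T.integrable_carrier (by fun_prop))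
    (by rw [div_mul_eq_mul_div, le_div_iff₀ (by positivity), mul_comm]; exact h)
  have h3 : ∫ x in T.carrier,
      (-(polyVal (bubble i lam) x * (polyVal r₀ x - T.gap i x * polyVal s x))) ^ 2 ≤
      W ^ 2 * ∫ x in T.carrier, (polyVal r₀ x - T.gap i x * polyVal s x) ^ 2 := by
    rw [← integral_const_mul]
    refine integral_carrier_mono (by fun_prop) (by fun_prop) fun x hx => ?_
    rw [neg_sq, mul_pow]
    exact mul_le_mul_of_nonneg_right
      (pow_le_pow_left₀ (polyVal_bubble_nonneg i lam x) (hW x hx) 2) (sq_nonneg _)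
  calc σ ^ 4 * ∫ x in T.carrier, polyVal t x ^ 2
      ≤ σ ^ 4 * ((F / σ ^ 2) ^ 2 * (W ^ 2 *
        ∫ x in T.carrier, (polyVal r₀ x - T.gap i x * polyVal s x) ^ 2)) := by
        refine mul_le_mul_of_nonneg_left (h2.trans ?_) (by positivity)
        exact mul_le_mul_of_nonneg_left h3 (by positivity)
    _ = _ := by field_simp

theorem integral_sq_le (hex : T.IsExpansion i lam k g q r₀ s t) {W H : ℝ}
    (hH : ∀ x ∈ T.carrier, T.gap i x ≤ H)
    (hW : ∀ x ∈ T.carrier, polyVal (bubble i lam) x ≤ W) :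
    ∫ x in T.carrier, polyVal q x ^ 2 ≤
      2 * W ^ 2 * (∫ x in T.carrier, (polyVal r₀ x - T.gap i x * polyVal s x) ^ 2) +
        2 * W ^ 2 * H ^ 4 * ∫ x in T.carrier, polyVal t x ^ 2 := by
  rw [← integral_const_mul, ← integral_const_mul,
    ← integral_add (T.integrable_carrier (by fun_prop)) (T.integrable_carrier (by fun_prop))]
  refine integral_carrier_mono (by fun_prop) (by fun_prop) fun x hx => ?_
  have h1 := pow_le_pow_left₀ (T.mem_carrier_iff.1 hx i) (hH x hx) 4
  have h2 := mul_le_mul_of_nonneg_right h1 (sq_nonneg (polyVal t x))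
  have h3 := pow_le_pow_left₀ (polyVal_bubble_nonneg i lam x) (hW x hx) 2
  have h4 : polyVal q x = polyVal (bubble i lam) x *
      ((polyVal r₀ x - T.gap i x * polyVal s x) + T.gap i x ^ 2 * polyVal t x) := by
    rw [hex.eq]
    simp only [polyVal_mul, polyVal_add, polyVal_pow, polyVal_facetPoly]
    ring
  generalize polyVal r₀ x - T.gap i x * polyVal s x = a at *
  have h5 : (a + T.gap i x ^ 2 * polyVal t x) ^ 2 ≤ 2 * a ^ 2 + 2 * (H ^ 4 * polyVal t x ^ 2) := by
    have h6 := sq_nonneg (a - T.gap i x ^ 2 * polyVal t x)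
    linarith
  rw [h4, mul_pow]
  calc polyVal (bubble i lam) x ^ 2 * (a + T.gap i x ^ 2 * polyVal t x) ^ 2 ≤
        W ^ 2 * (2 * a ^ 2 + 2 * (H ^ 4 * polyVal t x ^ 2)) :=
        mul_le_mul h3 h5 (sq_nonneg _) (sq_nonneg _)
    _ = _ := by ring

end IsExpansion

theorem integral_linear_part_le (r₀ s : MvPolynomial (Fin d) ℝ) {H : ℝ}
    (hH : ∀ x ∈ T.carrier, T.gap i x ≤ H) :
    ∫ x in T.carrier, (polyVal r₀ x - T.gap i x * polyVal s x) ^ 2 ≤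
      2 * (∫ x in T.carrier, polyVal r₀ x ^ 2) +
        2 * H ^ 2 * ∫ x in T.carrier, polyVal s x ^ 2 := by
  rw [← integral_const_mul, ← integral_const_mul,
    ← integral_add (T.integrable_carrier (by fun_prop)) (T.integrable_carrier (by fun_prop))]
  refine integral_carrier_mono (by fun_prop) (by fun_prop) fun x hx => ?_
  have h1 := pow_le_pow_left₀ (T.mem_carrier_iff.1 hx i) (hH x hx) 2
  have h2 := mul_le_mul_of_nonneg_right h1 (sq_nonneg (polyVal s x))
  have h3 := sq_nonneg (polyVal r₀ x + T.gap i x * polyVal s x)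
  linarith

/-- The stability estimate for squared norms. -/
theorem exists_integral_sq_le (d n k : ℕ) (hd : 1 ≤ d) (hk : 1 ≤ k) {α₀ ρ κ : ℝ} (hα₀ : 0 < α₀)
    (hρ : 0 < ρ) (hκ : 0 < κ) :
    ∃ C : ℝ, 0 < C ∧
      ∀ (T : ConvexPolytope d n) (i : Fin n) (lam : Fin n → MvPolynomial (Fin d) ℝ),
        T.IsRegularAt i α₀ ρ κ → T.IsWeightFamily i lam →
        ∀ g q : MvPolynomial (Fin d) ℝ, T.IsBubbleExtension i lam k g q →
          ∫ x in T.carrier, polyVal q x ^ 2 ≤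
            C * Metric.diam T.carrier * ∫ x, polyVal g x ^ 2 ∂(T.surfaceMeasure i) := by
  obtain ⟨c, A, Λ, Cv, hc, hA, hΛ, hCv, hgeo⟩ := exists_regularity_constants hd hα₀ hρ hκ
  obtain ⟨F₀, hF₀, hcoer₀⟩ := exists_face_coercive d n (k + 1) hd
  obtain ⟨F₁, hF₁, hcoer₁⟩ := exists_face_coercive d n k hd
  obtain ⟨F₂, hF₂, hcoer₂⟩ := exists_carrier_coercive d n (k - 1) hd
  obtain ⟨E₀, hE₀, hext₀⟩ := exists_integral_carrier_le_face d (k + 1) hd hc hCv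
  obtain ⟨E₁, hE₁, hext₁⟩ := exists_integral_carrier_le_face d k hd hc hCv
  set W : ℝ := (Λ ^ 2 + 1) ^ (n - 1) with hW
  have hW0 : 0 < W := by positivity
  set B : ℝ := (n - 1 : ℕ) * W * (2 * Λ * A) with hB
  have hB0 : 0 ≤ B := by positivity
  set U : ℝ := 2 * E₀ * F₀ ^ 2 + 2 * Λ ^ 2 * E₁ * F₁ ^ 2 * B ^ 2 * F₀ ^ 2 with hU
  have hU0 : 0 < U := by positivity
  refine ⟨2 * W ^ 2 * (1 + Λ ^ 4 * F₂ ^ 2 * W ^ 2) * U, by positivity,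
    fun T i lam hreg hlam g q hq => ?_⟩
  obtain ⟨σ, hσ, hσh, hσm, hball, hdepth, hgap, hinner, hvol⟩ := hgeo T i hreg
  obtain ⟨r₀, s, t, hex⟩ := hq.exists_isExpansion hd hk
  have hwle : ∀ x ∈ T.carrier, polyVal (bubble i lam) x ≤ W := fun x hx =>
    hlam.polyVal_bubble_le hd hgap hx
  have hr₀ := hex.integral_trace_le hd hF₀ (hcoer₀ T i lam hlam r₀ hex.degree₀)
  have hs := hex.integral_normal_deriv_le hd hF₁ (hcoer₁ T i lam hlam s hex.degree₁)
    fun x hx => hlam.abs_polyDeriv_bubble_le hd hA hΛ hσ hgap hinner hx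
  rw [← hW, ← hB] at hs
  have hr₀T := hext₀ T i σ hσ hball hvol r₀ hex.degree₀ hex.proj₀
  have hsT := hext₁ T i σ hσ hball hvol s hex.degree₁ hex.proj₁
  have hu := integral_linear_part_le r₀ s hdepth
  have ht := hex.integral_orthogonal_le hF₂ hσ (hcoer₂ T i lam hlam σ hσ hσm t hex.degree₂) hwle
  have hq := hex.integral_sq_le hdepth hwle
  have hG0 : 0 ≤ ∫ x, polyVal g x ^ 2 ∂(T.surfaceMeasure i) := integral_nonneg fun x => sq_nonneg _
  generalize ∫ x, polyVal g x ^ 2 ∂(T.surfaceMeasure i) = G at *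
  generalize ∫ x, polyVal r₀ x ^ 2 ∂(T.surfaceMeasure i) = R at *
  generalize ∫ x, polyVal s x ^ 2 ∂(T.surfaceMeasure i) = S at *
  generalize ∫ x in T.carrier, (polyVal r₀ x - T.gap i x * polyVal s x) ^ 2 = I at *
  generalize ∫ x in T.carrier, polyVal r₀ x ^ 2 = RT at *
  generalize ∫ x in T.carrier, polyVal s x ^ 2 = ST at *
  generalize ∫ x in T.carrier, polyVal t x ^ 2 = TT at *
  have hI : I ≤ U * σ * G := by
    calc I ≤ 2 * RT + 2 * (Λ * σ) ^ 2 * ST := hu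
      _ ≤ 2 * (E₀ * σ * R) + 2 * (Λ * σ) ^ 2 * (E₁ * σ * (F₁ ^ 2 * ((B / σ) ^ 2 * R))) := by
          gcongr
          exact hsT.trans (mul_le_mul_of_nonneg_left hs (by positivity))
      _ = (2 * E₀ + 2 * Λ ^ 2 * E₁ * F₁ ^ 2 * B ^ 2) * σ * R := by field_simp
      _ ≤ (2 * E₀ + 2 * Λ ^ 2 * E₁ * F₁ ^ 2 * B ^ 2) * σ * (F₀ ^ 2 * G) := by gcongr
      _ = U * σ * G := by rw [hU]; ring
  calc ∫ x in T.carrier, polyVal q x ^ 2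
      ≤ 2 * W ^ 2 * I + 2 * W ^ 2 * (Λ * σ) ^ 4 * TT := hq
    _ = 2 * W ^ 2 * I + 2 * W ^ 2 * Λ ^ 4 * (σ ^ 4 * TT) := by ring
    _ ≤ 2 * W ^ 2 * I + 2 * W ^ 2 * Λ ^ 4 * (F₂ ^ 2 * W ^ 2 * I) := by gcongr
    _ = 2 * W ^ 2 * (1 + Λ ^ 4 * F₂ ^ 2 * W ^ 2) * I := by ring
    _ ≤ 2 * W ^ 2 * (1 + Λ ^ 4 * F₂ ^ 2 * W ^ 2) * (U * Metric.diam T.carrier * G) := by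
        refine mul_le_mul_of_nonneg_left (hI.trans ?_) (by positivity)
        gcongr
    _ = _ := by ring

end ConvexPolytope

end

theorem mainTheorem6 (d : ℕ) (hd : d = 2 ∨ d = 3) (n k : ℕ) (hk : 1 ≤ k) :
    (∀ (T : ConvexPolytope d n) (i : Fin n) (lam : Fin n → MvPolynomial (Fin d) ℝ),
      T.IsWeightFamily i lam → ∀ g ∈ PolyDeg d (k - 1),
        ∃! q : MvPolynomial (Fin d) ℝ, T.IsBubbleExtension i lam k g q) ∧
    ∀ α₀ ρ κ : ℝ, 0 < α₀ → 0 < ρ → 0 < κ →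
      ∃ C : ℝ, 0 < C ∧
        ∀ (T : ConvexPolytope d n) (i : Fin n) (lam : Fin n → MvPolynomial (Fin d) ℝ),
          T.IsRegularAt i α₀ ρ κ → T.IsWeightFamily i lam →
          ∀ g ∈ PolyDeg d (k - 1), ∀ q : MvPolynomial (Fin d) ℝ,
            T.IsBubbleExtension i lam k g q →
              T.normL2 q ≤ C * Metric.diam T.carrier ^ (1 / 2 : ℝ) * T.faceNormL2 i g := by
  have hd1 : 1 ≤ d := by omega
  refine ⟨fun T i lam hlam g _ => ConvexPolytope.existsUnique_isBubbleExtension hd1 hk hlam g,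
    fun α₀ ρ κ hα₀ hρ hκ => ?_⟩
  obtain ⟨C, hC, h⟩ := ConvexPolytope.exists_integral_sq_le d n k hd1 hk hα₀ hρ hκ
  refine ⟨√C, Real.sqrt_pos.2 hC, fun T i lam hreg hlam g _ q hq => ?_⟩
  rw [← Real.sqrt_eq_rpow, ConvexPolytope.normL2, ConvexPolytope.faceNormL2,
    ← Real.sqrt_mul hC.le, ← Real.sqrt_mul (mul_nonneg hC.le Metric.diam_nonneg)]
  exact Real.sqrt_le_sqrt (h T i lam hreg hlam g q hq)
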